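/- **Setting.** Let $L, L_{\rm anc}, k \ge 0$ be integers and $n = L + L_{\rm anc}$. Let $a_0,\dots,a_{n-1}$ be the fermionic annihilation operators on the $2^n$-dimensional Fock space with orthonormal occupation-number basis $|\boldsymbol n\rangle = (a_0^\dagger)^{n_0}\cdots(a_{n-1}^\dagger)^{n_{n-1}}|\boldsymbol 0\rangle$, $\boldsymbol n\in\{0,1\}^n$ (and likewise for $L$ modes). For $k$-tuples of modes put $a_{\boldsymbol i}^\dagger a_{\boldsymbol j} := a_{i_1}^\dagger\cdots a_{i_k}^\dagger a_{j_1}\cdots a_{j_k}$, let $W_{2k}$ be the span of all these operators on $n$ modes, and let $\{A_l\}$ be its basis consisting of those with $i_1<\dots<i_k$ and $j_1<\dots<j_k$. For a unitary matrix $u \in \mathrm U(n)$ let $U$ be the Fock-space unitary with $U a_i U^\dagger = \sum_j u_{ij} a_j$ and $U|\boldsymbol 0\rangle = |\boldsymbol 0\rangle$. Let $\nu$ be a Borel probability measure on $\mathrm U(n)$ (for instance the normalized Haar measure of the group of symmetric circulant unitaries), and let $$\mathcal M(A) = \sum_{\boldsymbol n}\mathbb E_{u\sim\nu}\,\langle\boldsymbol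 n|UAU^\dagger|\boldsymbol n\rangle\,U^\dagger|\boldsymbol n\rangle\langle\boldsymbol n|U$$ be the measurement channel, $\mathcal M^+$ its Moore–Penrose pseudo-inverse with respect to the Hilbert–Schmidt inner product, and $M^+_{s,l}$ the matrix elements of $\mathcal M^+$ on $W_{2k}$, i.e. $\mathcal M^+(A_l)=\sum_s M^+_{s,l}A_s$. For $O=\sum_l O_l A_l\in W_{2k}$ put $f(O)=\sum_s\big|\sum_l M^+_{s,l}O_l\big|$. **Proposition.** Let $\rho$ be a density matrix on $L$ modes and $\rho'=\rho\otimes|\boldsymbol 0\rangle\langle\boldsymbol 0|$ its extension by $L_{\rm anc}$ empty modes. Let $S$ be a set of $M_{\rm tot}\ge 1$ distinct pairs $(\boldsymbol i,\boldsymbol j)$ of $k$-tuples in $\{0,\dots,L-1\}$. For each $(\boldsymbol i,\boldsymbol j)\in S$ let $O^{(\boldsymbol i,\boldsymbol j)}\in W_{2k}$ be an operator on the $n$ modes which lies in the image of $\mathcal M$ and satisfies $\mathrm{Tr}(\rho' O^{(\boldsymbol i,\boldsymbol j)})=\mathrm{Tr}(\rho\, a_{\boldsymbol i}^\dagger a_{\boldsymbol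 j})$. Let $(u^{(m)},\boldsymbol n^{(m)})$, $m=1,\dots,N$, be independent rounds of the following experiment: draw $u\sim\nu$ and measure $U\rho'U^\dagger$ in the occupation-number basis, so that given $u$ the outcome $\boldsymbol n$ has probability $\langle\boldsymbol n|U\rho'U^\dagger|\boldsymbol n\rangle$. Put $$\hat X^{(\boldsymbol i,\boldsymbol j)}=\frac1N\sum_{m=1}^N\langle\boldsymbol n^{(m)}|U^{(m)}\mathcal M^+(O^{(\boldsymbol i,\boldsymbol j)})U^{(m)\dagger}|\boldsymbol n^{(m)}\rangle .$$ Let $\epsilon,\delta>0$. If $$N\ \ge\ \frac{4}{\epsilon^2}\log\Big(\frac{4M_{\rm tot}}{\delta}\Big)\max_{(\boldsymbol i,\boldsymbol j)\in S} f(O^{(\boldsymbol i,\boldsymbol j)})^2,$$ then with probability at least $1-\delta$ $$\max_{(\boldsymbol i,\boldsymbol j)\in S}\big|\hat X^{(\boldsymbol i,\boldsymbol j)}-\mathrm{Tr}(\rho\, a_{\boldsymbol i}^\dagger a_{\boldsymbol j})\big|<\epsilon .$$ (For $N=0$ the empty mean is read as $0$.) -/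

import Mathlib

open MeasureTheory ProbabilityTheory
open scoped ComplexOrder

namespace FermionShadows

/-- Occupation patterns `(n_0, …, n_{n-1})` of `n` fermionic modes; they label the Fock basis. -/
abbrev Occ (n : ℕ) : Type := Fin n → Bool

/-- Operators on the `2 ^ n`-dimensional Fock space, as matrices in the Fock basis. -/
abbrev Op (n : ℕ) : Type := Matrix (Occ n) (Occ n) ℂ

/-- The vacuum pattern. -/
def vac (n : ℕ) : Occ n := fun _ => false

/-- The annihilation operator `a_j`. With the Fock basis
`|y⟩ = (a_0†)^{y_0} ⋯ (a_{n-1}†)^{y_{n-1}} |0⟩` it sends `|y⟩` to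
`(-1)^{y_0 + ⋯ + y_{j-1}} |y - e_j⟩` if `y_j = 1`, and to `0` otherwise. -/
noncomputable def ann {n : ℕ} (j : Fin n) : Op n :=
  Matrix.of fun x y =>
    if y j = true ∧ x = Function.update y j false then
      (-1 : ℂ) ^ (Finset.univ.filter fun i : Fin n => i < j ∧ y i = true).card
    else 0

/-- The creation operator `a_j†`. -/
noncomputable def cre {n : ℕ} (j : Fin n) : Op n := (ann j).conjTranspose

/-- The correlation operator `a_{i_1}† ⋯ a_{i_k}† a_{j_1} ⋯ a_{j_k}`. -/
noncomputable def corr {n k : ℕ} (i j : Fin k → Fin n) : Op n :=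
  (List.ofFn fun r => cre (i r)).prod * (List.ofFn fun r => ann (j r)).prod

/-- The `2k`-point operator space: the span of all `2k`-point correlation operators. -/
noncomputable def twoKPointSpace (n k : ℕ) : Submodule ℂ (Op n) :=
  Submodule.span ℂ
    (Set.range fun p : (Fin k → Fin n) × (Fin k → Fin n) => corr p.1 p.2)

/-- Labels of the basis of the `2k`-point space: pairs of strictly increasing `k`-tuples. -/
abbrev Idx (n k : ℕ) : Type := (Fin k ↪o Fin n) × (Fin k ↪o Fin n)

noncomputable instance instFintypeIdx (n k : ℕ) : Fintype (Idx n k) := Fintype.ofFinite _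

/-- The basis operators `A_l = a_{i_1}† ⋯ a_{i_k}† a_{j_1} ⋯ a_{j_k}` with `i_1 < ⋯ < i_k` and
`j_1 < ⋯ < j_k`. -/
noncomputable def basisOp {n k : ℕ} (l : Idx n k) : Op n := corr l.1 l.2

/-- Emptying the modes of the list `l`. -/
def emptied {n : ℕ} (l : List (Fin n)) (y : Occ n) : Occ n := fun i => if i ∈ l then false else y i

theorem ann_prod_apply {n : ℕ} (l : List (Fin n)) (hl : l.Nodup) :
    ∃ s : Occ n → ℂ, (∀ y, s y ≠ 0) ∧ ∀ x y, (l.map ann).prod x y =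
      if (∀ j ∈ l, y j = true) ∧ x = emptied l y then s y else 0 := by
  induction l with
  | nil =>
    refine ⟨fun _ => 1, by simp, fun x y => ?_⟩
    have : emptied [] y = y := by funext i; simp [emptied]
    simp [this, Matrix.one_apply]
  | cons a l ih =>
    obtain ⟨s, hs, h⟩ := ih (List.nodup_cons.mp hl).2
    have ha : a ∉ l := (List.nodup_cons.mp hl).1
    refine ⟨fun y => (-1 : ℂ) ^ (Finset.univ.filter
      fun i : Fin n => i < a ∧ emptied l y i = true).card * s y, fun y => ?_, fun x y => ?_⟩
    · exact mul_ne_zero (pow_ne_zero _ (by norm_num)) (hs y)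
    · have h1 : emptied (a :: l) y = Function.update (emptied l y) a false := by
        funext i
        by_cases hi : i = a
        · subst hi; simp [emptied]
        · simp [emptied, hi]
      have h2 : emptied l y a = y a := by simp [emptied, ha]
      rw [List.map_cons, List.prod_cons, Matrix.mul_apply, Finset.sum_eq_single (emptied l y)]
      · rw [h, h1]
        simp only [ann, Matrix.of_apply, h2, List.forall_mem_cons]
        split_ifs <;> simp_all
      · intro z _ hz
        rw [h, if_neg (fun hh => hz hh.2), mul_zero]
      · simp

theorem cre_prod {n : ℕ} (l : List (Fin n)) :
    (l.map cre).prod = ((l.reverse.map ann).prod).conjTranspose := by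
  rw [Matrix.conjTranspose_list_prod, List.map_map, ← List.map_reverse, List.reverse_reverse]
  rfl

theorem corr_apply {n k : ℕ} (l : Idx n k) : ∃ s : Occ n → Occ n → ℂ, (∀ x y, s x y ≠ 0) ∧
    ∀ x y, (basisOp l : Op n) x y =
      if (∀ r, x (l.1 r) = true) ∧ (∀ r, y (l.2 r) = true) ∧
        emptied (List.ofFn l.1) x = emptied (List.ofFn l.2) y then s x y else 0 := by
  have hn : ∀ i : Fin k ↪o Fin n, (List.ofFn i).Nodup := fun i => List.nodup_ofFn.mpr i.injective
  obtain ⟨s, hs, h⟩ := ann_prod_apply (List.ofFn l.1).reverse (List.nodup_reverse.mpr (hn l.1))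
  obtain ⟨t, ht, h'⟩ := ann_prod_apply (List.ofFn l.2) (hn l.2)
  have hr : ∀ x : Occ n, emptied (List.ofFn l.1).reverse x = emptied (List.ofFn l.1) x := by
    intro x; funext i; simp [emptied]
  refine ⟨fun x y => star (s x) * t y,
    fun x y => mul_ne_zero (star_ne_zero.mpr (hs x)) (ht y), fun x y => ?_⟩
  have e1 : (List.ofFn fun r => cre (l.1 r) : List (Op n)) = (List.ofFn l.1).map cre := by
    rw [List.map_ofFn]; rfl
  have e2 : (List.ofFn fun r => ann (l.2 r) : List (Op n)) = (List.ofFn l.2).map ann := by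
    rw [List.map_ofFn]; rfl
  rw [basisOp, corr, e1, e2, cre_prod, Matrix.mul_apply,
    Finset.sum_eq_single (emptied (List.ofFn l.1) x)]
  · rw [Matrix.conjTranspose_apply, h, h', hr]
    simp only [List.mem_reverse, List.forall_mem_ofFn_iff, and_true]
    split_ifs <;> simp_all
  · intro z _ hz
    rw [Matrix.conjTranspose_apply, h, if_neg (fun hh => hz (hh.2.trans (hr x))), star_zero,
      zero_mul]
  · simp

theorem linearIndependent_basisOp (n k : ℕ) :
    LinearIndependent ℂ (basisOp : Idx n k → Op n) := by
  rw [Fintype.linearIndependent_iff]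
  intro c hc l
  let ind : (Fin k ↪o Fin n) → Occ n := fun i m => decide (m ∈ Set.range i)
  have hind : ∀ i j : Fin k ↪o Fin n, (∀ r, ind i (j r) = true) → j = i := by
    intro i j h
    have hsub : Set.range j ⊆ Set.range i := by
      rintro _ ⟨r, rfl⟩
      simpa [ind] using h r
    have : Set.range j = Set.range i := by
      refine Set.eq_of_subset_of_ncard_le hsub ?_ (Set.toFinite _)
      rw [← Set.image_univ, ← Set.image_univ, Set.ncard_image_of_injective _ i.injective,
        Set.ncard_image_of_injective _ j.injective]
    exact OrderEmbedding.range_inj.mp this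
  have hself : ∀ i : Fin k ↪o Fin n, emptied (List.ofFn i) (ind i) = vac n := by
    intro i; funext m
    by_cases hm : m ∈ Set.range i
    · obtain ⟨r, hr⟩ := hm
      simp only [emptied, vac, List.mem_ofFn, ite_eq_left_iff]
      exact fun h => absurd ⟨r, hr⟩ h
    · simp [emptied, vac, List.mem_ofFn, ind]
  have h0 := congrFun (congrFun hc (ind l.1)) (ind l.2)
  rw [Matrix.sum_apply, Finset.sum_eq_single l] at h0
  · obtain ⟨s, hs, h⟩ := corr_apply l
    rw [Matrix.smul_apply, h, if_pos ?_] at h0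
    · exact (mul_eq_zero.mp h0).resolve_right (hs _ _)
    · exact ⟨fun r => by simp [ind], fun r => by simp [ind], by rw [hself, hself]⟩
  · intro m _ hm
    obtain ⟨s, _, h⟩ := corr_apply m
    rw [Matrix.smul_apply, h, if_neg, smul_zero]
    rintro ⟨h1, h2, _⟩
    exact hm (Prod.ext (hind _ _ h1) (hind _ _ h2))
  · simp

open Classical in
/-- The coordinates `(X_l)_l` of an operator `X = ∑ l, X_l A_l` of the `2k`-point space
(they are unique by `coord_sum` below; the value is `0` for `X` outside that space). -/
noncomputable def coord {n k : ℕ} (X : Op n) : Idx n k → ℂ :=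
  if h : ∃ c : Idx n k → ℂ, ∑ l, c l • basisOp l = X then h.choose else 0

theorem coord_sum {n k : ℕ} (c : Idx n k → ℂ) : coord (∑ l, c l • basisOp l : Op n) = c := by
  have h : ∃ c' : Idx n k → ℂ, ∑ l, c' l • basisOp l = (∑ l, c l • basisOp l : Op n) := ⟨c, rfl⟩
  rw [coord, dif_pos h]
  funext l
  have h1 : ∑ l, (h.choose l - c l) • (basisOp l : Op n) = 0 := by
    simp only [sub_smul, Finset.sum_sub_distrib, h.choose_spec, sub_self]
  exact sub_eq_zero.mp
    (Fintype.linearIndependent_iff.mp (linearIndependent_basisOp n k) _ h1 l)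

/-- The Fock space unitary `U` belonging to the mode space unitary `u`, normalised by
`U |0⟩ = |0⟩`. Since `U a_j† U† = ∑ k, conj (u j k) a_k†`, it maps `|y⟩` to
`∏_j (∑ k, conj (u j k) a_k†)^{y_j} |0⟩`, the factors being ordered by increasing `j`. -/
noncomputable def fockU {n : ℕ} (u : Matrix (Fin n) (Fin n) ℂ) : Op n :=
  Matrix.of fun x y =>
    (List.ofFn fun j : Fin n =>
      if y j = true then ∑ k, star (u j k) • cre k else (1 : Op n)).prod x (vac n)

/-- The unitary group of the mode space, with its Borel sigma-algebra. -/
abbrev ModeUnitary (n : ℕ) : Type := Matrix.unitaryGroup (Fin n) ℂ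

noncomputable instance instMeasurableSpaceU (n : ℕ) : MeasurableSpace (ModeUnitary n) := borel _

instance instBorelSpaceU (n : ℕ) : BorelSpace (ModeUnitary n) := ⟨rfl⟩

instance instCompactSpaceU (n : ℕ) : CompactSpace (ModeUnitary n) := by
  have hK : IsCompact {A : Matrix (Fin n) (Fin n) ℂ | ∀ i j, A i j ∈ Metric.closedBall (0 : ℂ) 1} := by
    have h := isCompact_univ_pi fun _ : Fin n => isCompact_univ_pi fun _ : Fin n =>
      isCompact_closedBall (0 : ℂ) 1
    have h2 : IsCompact {A : Fin n → Fin n → ℂ | ∀ i j, A i j ∈ Metric.closedBall (0 : ℂ) 1} := by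
      simpa [Set.pi] using h
    exact h2
  refine isCompact_iff_compactSpace.mp (hK.of_isClosed_subset ?_ ?_)
  · have h : {A : Matrix (Fin n) (Fin n) ℂ | A * star A = 1} =
        (Matrix.unitaryGroup (Fin n) ℂ : Set (Matrix (Fin n) (Fin n) ℂ)) := by
      ext A
      simp [Matrix.mem_unitaryGroup_iff]
    rw [← h]
    exact isClosed_eq (continuous_id.matrix_mul continuous_id.matrix_conjTranspose)
      continuous_const
  · intro A hA i j
    simpa using entry_norm_bound_of_unitary hA i j

theorem continuous_fockU (n : ℕ) : Continuous fun u : ModeUnitary n => fockU (u : Matrix (Fin n) (Fin n) ℂ) := by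
  have hu : ∀ j k, Continuous fun u : ModeUnitary n => (u : Matrix (Fin n) (Fin n) ℂ) j k := fun j k =>
    (continuous_subtype_val (p := fun A => A ∈ Matrix.unitaryGroup (Fin n) ℂ)).matrix_elem j k
  refine continuous_matrix fun x y => ?_
  simp only [fockU, Matrix.of_apply, List.ofFn_eq_map]
  refine Continuous.matrix_elem ?_ _ _
  refine continuous_list_prod _ fun j _ => ?_
  split_ifs
  · exact continuous_finsetSum _ fun k _ => (hu j k).star.smul continuous_const
  · exact continuous_const

/-- The contribution of the unitary `u` to the measurement channel:
`∑ x, ⟨x|U A U†|x⟩ U†|x⟩⟨x|U`, where `(U†|x⟩⟨x|U) p q = conj (U x p) * U x q`. -/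
noncomputable def shot {n : ℕ} (u : Matrix (Fin n) (Fin n) ℂ) (A : Op n) : Op n :=
  ∑ x, (fockU u * A * (fockU u).conjTranspose) x x •
    ((fockU u).conjTranspose * Matrix.single x x 1 * fockU u)

theorem integrable_shot {n : ℕ} (ν : Measure (ModeUnitary n)) [IsProbabilityMeasure ν] (A : Op n)
    (p q : Occ n) : Integrable (fun u : ModeUnitary n => shot (u : Matrix (Fin n) (Fin n) ℂ) A p q) ν := by
  have hF := continuous_fockU n
  have h : Continuous fun u : ModeUnitary n => shot (u : Matrix (Fin n) (Fin n) ℂ) A := by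
    unfold shot
    refine continuous_finsetSum _ fun x _ => ?_
    exact (((hF.matrix_mul continuous_const).matrix_mul hF.matrix_conjTranspose).matrix_elem x x).smul
      ((hF.matrix_conjTranspose.matrix_mul continuous_const).matrix_mul hF)
  exact (h.matrix_elem p q).integrable_of_hasCompactSupport (HasCompactSupport.of_compactSpace _)

/-- The measurement channel `A ↦ ∑ x, 𝔼_{u ∼ ν} ⟨x|U A U†|x⟩ U†|x⟩⟨x|U` of the ensemble `ν`. -/
noncomputable def channel {n : ℕ} (ν : Measure (ModeUnitary n)) [IsProbabilityMeasure ν] :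
    Op n →ₗ[ℂ] Op n where
  toFun A := Matrix.of fun p q => ∫ u : ModeUnitary n, shot (u : Matrix (Fin n) (Fin n) ℂ) A p q ∂ν
  map_add' A B := by
    ext p q
    have h : ∀ u : ModeUnitary n, shot (u : Matrix (Fin n) (Fin n) ℂ) (A + B) p q =
        shot (u : Matrix (Fin n) (Fin n) ℂ) A p q + shot (u : Matrix (Fin n) (Fin n) ℂ) B p q := by
      intro u
      simp [shot, Matrix.mul_add, Matrix.add_mul, add_smul, Finset.sum_add_distrib]
    simp only [Matrix.of_apply, Matrix.add_apply, h]
    exact integral_add (integrable_shot ν A p q) (integrable_shot ν B p q)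
  map_smul' c A := by
    ext p q
    have h : ∀ u : ModeUnitary n, shot (u : Matrix (Fin n) (Fin n) ℂ) (c • A) p q =
        c * shot (u : Matrix (Fin n) (Fin n) ℂ) A p q := by
      intro u
      simp [shot, Matrix.sum_apply, Finset.mul_sum, mul_assoc]
    simp only [Matrix.of_apply, Matrix.smul_apply, h, RingHom.id_apply, smul_eq_mul]
    exact integral_const_mul c _

/-- The Hilbert–Schmidt inner product `Tr (A† B)`. -/
noncomputable def hs {n : ℕ} (A B : Op n) : ℂ := (A.conjTranspose * B).trace

/-- The four Penrose conditions, with respect to the Hilbert–Schmidt inner product. -/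
structure IsMoorePenrose {n : ℕ} (T P : Op n →ₗ[ℂ] Op n) : Prop where
  map_inv_map : ∀ A, T (P (T A)) = T A
  inv_map_inv : ∀ A, P (T (P A)) = P A
  map_inv_symm : ∀ A B, hs (T (P A)) B = hs A (T (P B))
  inv_map_symm : ∀ A B, hs (P (T A)) B = hs A (P (T B))

theorem IsMoorePenrose.unique {n : ℕ} {T P Q : Op n →ₗ[ℂ] Op n} (hP : IsMoorePenrose T P)
    (hQ : IsMoorePenrose T Q) : P = Q := by
  have nd : ∀ X Y : Op n, (∀ B, hs X B = hs Y B) → X = Y := by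
    intro X Y h
    have h1 := h (X - Y)
    have h2 : ((X - Y).conjTranspose * (X - Y)).trace = 0 := by
      simpa [hs, Matrix.sub_mul, sub_eq_zero] using h1
    exact sub_eq_zero.mp (Matrix.trace_conjTranspose_mul_self_eq_zero_iff.mp h2)
  have h1 : ∀ A, T (P A) = T (Q A) := fun A => nd _ _ fun B => by
    rw [← hQ.map_inv_map (P A), hQ.map_inv_symm, hP.map_inv_symm, hP.map_inv_map,
      ← hQ.map_inv_symm]
  have h2 : ∀ A, P (T A) = Q (T A) := fun A => nd _ _ fun B => by
    rw [hQ.inv_map_symm, ← hP.map_inv_map B, ← hQ.inv_map_symm, ← hP.inv_map_symm,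
      hQ.map_inv_map]
  ext1 A
  rw [← hP.inv_map_inv A, h2, h1, hQ.inv_map_inv]

theorem exists_isMoorePenrose {n : ℕ} (T : Op n →ₗ[ℂ] Op n) :
    ∃ P : Op n →ₗ[ℂ] Op n, IsMoorePenrose T P := by
  let e : Op n ≃ₗ[ℂ] EuclideanSpace ℂ (Occ n × Occ n) :=
    (LinearEquiv.curry ℂ ℂ (Occ n) (Occ n)).symm ≪≫ₗ (WithLp.linearEquiv 2 ℂ _).symm
  have he : ∀ A B : Op n, inner ℂ (e A) (e B) = hs A B := by
    intro A B
    have h1 : ∀ (A : Op n) p, (e A) p = A p.1 p.2 := fun A p => rfl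
    simp only [PiLp.inner_apply, h1, hs, Matrix.trace, Matrix.diag, Matrix.mul_apply,
      Matrix.conjTranspose_apply, Fintype.sum_prod_type]
    rw [Finset.sum_comm]
    simp [mul_comm]
  let T' : EuclideanSpace ℂ (Occ n × Occ n) →ₗ[ℂ] EuclideanSpace ℂ (Occ n × Occ n) :=
    e.toLinearMap ∘ₗ T ∘ₗ e.symm.toLinearMap
  have hc : IsCompl (LinearMap.ker T')ᗮ (LinearMap.ker T') :=
    (Submodule.isCompl_orthogonal (K := LinearMap.ker T')).symm
  let g := LinearMap.kerComplementEquivRange T' hc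
  let P' : EuclideanSpace ℂ (Occ n × Occ n) →ₗ[ℂ] EuclideanSpace ℂ (Occ n × Occ n) :=
    (LinearMap.ker T')ᗮ.subtype ∘ₗ g.symm.toLinearMap ∘ₗ
      (LinearMap.range T').orthogonalProjectionOnto.toLinearMap
  have hg : ∀ y : LinearMap.range T', T' (g.symm y : EuclideanSpace ℂ (Occ n × Occ n)) = y := by
    intro y
    have h : g (g.symm y) = y := g.apply_symm_apply y
    exact congrArg Subtype.val h
  have hTP : ∀ y, T' (P' y) = (LinearMap.range T').orthogonalProjectionOnto y := fun y => hg _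
  have hPT : ∀ x, P' (T' x) = (LinearMap.ker T')ᗮ.orthogonalProjectionOnto x := by
    intro x
    have h0 : T' (P' (T' x)) = T' x := by
      rw [hTP]
      exact Submodule.starProjection_eq_self_iff.mpr (LinearMap.mem_range_self T' x)
    refine (Submodule.eq_starProjection_of_mem_orthogonal (K := (LinearMap.ker T')ᗮ) (u := x)
      (Subtype.mem _) ?_).symm
    rw [Submodule.orthogonal_orthogonal, LinearMap.mem_ker, map_sub, sub_eq_zero]
    exact h0.symm
  have hT : ∀ A, e (T A) = T' (e A) := fun A => by simp [T']
  have hP : ∀ A, e ((e.symm.toLinearMap ∘ₗ P' ∘ₗ e.toLinearMap) A) = P' (e A) :=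
    fun A => by simp
  refine ⟨e.symm.toLinearMap ∘ₗ P' ∘ₗ e.toLinearMap, ⟨?_, ?_, ?_, ?_⟩⟩
  · intro A
    apply e.injective
    rw [hT, hP, hT, hTP]
    exact Submodule.starProjection_eq_self_iff.mpr (LinearMap.mem_range_self T' _)
  · intro A
    apply e.injective
    rw [hP, hT, hP, hPT]
    exact Submodule.starProjection_eq_self_iff.mpr (Subtype.mem _)
  · intro A B
    rw [← he, ← he, hT, hP, hTP, hT, hP, hTP]
    exact Submodule.inner_starProjection_left_eq_right _ _ _
  · intro A B
    rw [← he, ← he, hP, hT, hPT, hP, hT, hPT]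
    exact Submodule.inner_starProjection_left_eq_right _ _ _

/-- The Moore–Penrose pseudo-inverse of a linear map on operators, with respect to the
Hilbert–Schmidt inner product. -/
noncomputable def pinv {n : ℕ} (T : Op n →ₗ[ℂ] Op n) : Op n →ₗ[ℂ] Op n :=
  (exists_isMoorePenrose T).choose

/-- The matrix elements `M⁺_{s,l}` of the pseudo-inverse channel in the basis `(A_l)_l` of the
`2k`-point space, that is `M⁺(A_l) = ∑ s, M⁺_{s,l} A_s`. -/
noncomputable def pinvCoeff {n : ℕ} (k : ℕ) (ν : Measure (ModeUnitary n)) [IsProbabilityMeasure ν]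
    (s l : Idx n k) : ℂ :=
  coord (pinv (channel ν) (basisOp l)) s

/-- The function `f(O) = ∑ s, |∑ l, M⁺_{s,l} O_l|`, where `O = ∑ l, O_l A_l`. -/
noncomputable def fBound {n : ℕ} (k : ℕ) (ν : Measure (ModeUnitary n)) [IsProbabilityMeasure ν] (O : Op n) : ℝ :=
  ∑ s : Idx n k, ‖∑ l : Idx n k, pinvCoeff k ν s l * coord O l‖

/-- Density matrices. -/
def IsDensity {n : ℕ} (ρ : Op n) : Prop := ρ.PosSemidef ∧ ρ.trace = 1

/-- The state `ρ ⊗ |0⟩⟨0|` on `L + Lanc` modes: the modes `0, …, L - 1` are in the state `ρ` and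
the remaining auxiliary modes are empty. -/
noncomputable def withAncilla {L : ℕ} (Lanc : ℕ) (ρ : Op L) : Op (L + Lanc) :=
  Matrix.of fun x y =>
    if (∀ a : Fin Lanc, x (Fin.natAdd L a) = false ∧ y (Fin.natAdd L a) = false) then
      ρ (fun i => x (Fin.castAdd Lanc i)) (fun i => y (Fin.castAdd Lanc i))
    else 0

/-- The law of the data `(u, x)` of one round on the state `σ`: `u` is drawn from `ν` and then,
given `u`, the outcome `x` of the occupation number measurement has probability
`⟨x|U σ U†|x⟩`. -/
noncomputable def roundLaw {n : ℕ} (ν : Measure (ModeUnitary n)) (σ : Op n) : Measure (ModeUnitary n × Occ n) :=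
  (ν.prod Measure.count).withDensity fun d =>
    ENNReal.ofReal ((fockU (d.1 : Matrix (Fin n) (Fin n) ℂ) * σ *
      (fockU (d.1 : Matrix (Fin n) (Fin n) ℂ)).conjTranspose) d.2 d.2).re

/-- The single-round estimate `⟨x|U M⁺(O) U†|x⟩` computed from the data `(u, x)`. -/
noncomputable def estimate {n : ℕ} (ν : Measure (ModeUnitary n)) [IsProbabilityMeasure ν] (O : Op n)
    (d : ModeUnitary n × Occ n) : ℂ :=
  (fockU (d.1 : Matrix (Fin n) (Fin n) ℂ) * pinv (channel ν) O *
    (fockU (d.1 : Matrix (Fin n) (Fin n) ℂ)).conjTranspose) d.2 d.2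

end FermionShadows

/-! The argument is Hoeffding's inequality plus a union bound, applied to a single-round estimator
that is unbiased and bounded by f(O).

Boundedness needs 𝓜⁺(O) to be a combination of the basis operators A_s with the coefficients that
occur in f(O), hence 𝓜⁺ must preserve the 2k-point space W. One shot of the channel conjugates by U,
deletes the off-diagonal entries and conjugates back. Conjugation maps creation operators to
combinations of creation operators, so it preserves W. The diagonal part of A_s is A_s itself or 0.
Averaging stays in the subspace (`channel_mem`). Since 𝓜 is Hilbert–Schmidt self-adjoint
(`channel_symm`), its pseudo-inverse preserves W as well (`IsMoorePenrose.map_mem`). Each A_s is a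
product of operators of norm at most 1 and U is unitary, so |⟨x|U A_s U†|x⟩| ≤ 1, and the triangle
inequality gives the bound f(O) (`norm_estimate_le`).

Unbiasedness (`integral_estimate`) is the identity Tr(σ 𝓜(𝓜⁺(O))) = Tr(σ O), valid because O lies in
the image of 𝓜.

`fockU` is defined only through its columns, so its unitarity and its action on the modes are
derived from the canonical anticommutation relations. The tool is uniqueness: an intertwiner of the
creation operators is determined by its value on the vacuum. -/

namespace FermionShadows

/-! ### Jordan–Wigner signs and the canonical anticommutation relations. -/

/-- The Jordan–Wigner sign `(-1)^{y_0 + ⋯ + y_{j-1}}`. -/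
noncomputable def jwSign {n : ℕ} (j : Fin n) (y : Occ n) : ℂ :=
  (-1 : ℂ) ^ (Finset.univ.filter fun i : Fin n => i < j ∧ y i = true).card

theorem jwSign_ne_zero {n : ℕ} (j : Fin n) (y : Occ n) : jwSign j y ≠ 0 :=
  pow_ne_zero _ (by norm_num)

theorem jwSign_mul_self {n : ℕ} (j : Fin n) (y : Occ n) : jwSign j y * jwSign j y = 1 := by
  rw [jwSign, ← mul_pow]; norm_num

theorem star_jwSign {n : ℕ} (j : Fin n) (y : Occ n) : star (jwSign j y) = jwSign j y := by
  simp [jwSign]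

theorem jwSign_update_of_le {n : ℕ} {i j : Fin n} (h : i ≤ j) (y : Occ n) (b : Bool) :
    jwSign i (Function.update y j b) = jwSign i y := by
  unfold jwSign
  congr 2
  ext m
  simp only [Finset.mem_filter, Finset.mem_univ, true_and]
  refine and_congr_right fun hm => ?_
  rw [Function.update_of_ne (hm.trans_le h).ne]

/-- For two distinct modes, only the sign of the higher one depends on the occupation of the lower
one. This asymmetry is the source of every minus sign in the anticommutation relations. -/
theorem jwSign_update_true {n : ℕ} {i j : Fin n} (h : j < i) {y : Occ n} (hy : y j = false) :
    jwSign i (Function.update y j true) = -jwSign i y := by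
  unfold jwSign
  have : (Finset.univ.filter fun m : Fin n => m < i ∧ Function.update y j true m = true) =
      insert j (Finset.univ.filter fun m : Fin n => m < i ∧ y m = true) := by
    ext m
    by_cases hm : m = j
    · subst hm; simp [h]
    · simp [hm]
  rw [this, Finset.card_insert_of_notMem (by simp [hy]), pow_succ]
  ring

theorem jwSign_update_false {n : ℕ} {i j : Fin n} (h : j < i) {y : Occ n} (hy : y j = true) :
    jwSign i (Function.update y j false) = -jwSign i y := by
  have h1 := jwSign_update_true h (y := Function.update y j false) (by simp)
  have h2 : Function.update y j true = y := by rw [← hy, Function.update_eq_self]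
  rw [Function.update_idem, h2] at h1
  rw [h1, neg_neg]

theorem mul_ann_apply {n : ℕ} (A : Op n) (j : Fin n) (x y : Occ n) :
    (A * ann j) x y =
      if y j = true then jwSign j y * A x (Function.update y j false) else 0 := by
  rw [Matrix.mul_apply, Finset.sum_eq_single (Function.update y j false)]
  · simp only [ann, Matrix.of_apply, jwSign]
    split_ifs <;> simp_all [mul_comm]
  · intro z _ hz
    simp [ann, hz]
  · simp

theorem cre_apply {n : ℕ} (j : Fin n) (x y : Occ n) :
    cre j x y = if y j = false ∧ x = Function.update y j true then jwSign j y else 0 := by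
  have h : (x j = true ∧ y = Function.update x j false) ↔
      (y j = false ∧ x = Function.update y j true) := by
    constructor
    · rintro ⟨h1, rfl⟩
      refine ⟨by simp, ?_⟩
      rw [Function.update_idem, ← h1, Function.update_eq_self]
    · rintro ⟨h1, rfl⟩
      refine ⟨by simp, ?_⟩
      rw [Function.update_idem, ← h1, Function.update_eq_self]
  simp only [cre, Matrix.conjTranspose_apply, ann, Matrix.of_apply]
  by_cases hc : y j = false ∧ x = Function.update y j true
  · rw [if_pos (h.mpr hc), if_pos hc, hc.2]
    exact (star_jwSign j _).trans (jwSign_update_of_le le_rfl y true)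
  · rw [if_neg (fun h' => hc (h.mp h')), if_neg hc, star_zero]

theorem mul_cre_apply {n : ℕ} (A : Op n) (j : Fin n) (x y : Occ n) :
    (A * cre j) x y =
      if y j = false then jwSign j y * A x (Function.update y j true) else 0 := by
  rw [Matrix.mul_apply, Finset.sum_eq_single (Function.update y j true)]
  · rw [cre_apply]
    split_ifs <;> simp_all [mul_comm]
  · intro z _ hz
    rw [cre_apply, if_neg (fun h => hz h.2), mul_zero]
  · simp

theorem ann_mul_apply {n : ℕ} (A : Op n) (j : Fin n) (x y : Occ n) :
    (ann j * A) x y =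
      if x j = false then jwSign j x * A (Function.update x j true) y else 0 := by
  have h : (ann j * A) x y = star ((A.conjTranspose * cre j) y x) := by
    rw [cre, ← Matrix.conjTranspose_mul, Matrix.conjTranspose_apply, star_star]
  rw [h, mul_cre_apply]
  split_ifs <;> simp [jwSign]

theorem ann_mul_ann {n : ℕ} (i j : Fin n) : (ann i * ann j : Op n) = -(ann j * ann i) := by
  have key : ∀ i j : Fin n, i < j → (ann i * ann j : Op n) = -(ann j * ann i) := by
    intro i j h
    ext x y
    have e1 : ∀ k x y, (ann k : Op n) x y = ((1 : Op n) * ann k) x y := by simp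
    rw [Matrix.neg_apply, mul_ann_apply, mul_ann_apply, e1 i, e1 j, mul_ann_apply, mul_ann_apply,
      Function.update_of_ne h.ne, Function.update_of_ne h.ne', Function.update_comm h.ne,
      jwSign_update_of_le h.le]
    by_cases hi : y i = true
    · by_cases hj : y j = true
      · rw [jwSign_update_false h hi]
        simp only [hi, hj, if_true]
        ring
      · simp [hj]
    · simp [hi]
  rcases lt_trichotomy i j with h | rfl | h
  · exact key i j h
  · ext x y
    have e1 : ∀ k x y, (ann k : Op n) x y = ((1 : Op n) * ann k) x y := by simp
    rw [Matrix.neg_apply, mul_ann_apply, e1 i, mul_ann_apply, Function.update_self]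
    simp
  · rw [key j i h, neg_neg]

theorem cre_mul_cre {n : ℕ} (i j : Fin n) : (cre i * cre j : Op n) = -(cre j * cre i) := by
  rw [cre, cre, ← Matrix.conjTranspose_mul, ann_mul_ann, Matrix.conjTranspose_neg,
    Matrix.conjTranspose_mul]

theorem ann_mul_cre_self {n : ℕ} (i : Fin n) : (ann i * cre i : Op n) = 1 - cre i * ann i := by
  ext x y
  have e1 : ∀ k x y, (ann k : Op n) x y = ((1 : Op n) * ann k) x y := by simp
  have e2 : ∀ k x y, (cre k : Op n) x y = ((1 : Op n) * cre k) x y := by simp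
  rw [Matrix.sub_apply, mul_ann_apply, mul_cre_apply, e1 i, e2 i, mul_cre_apply, mul_ann_apply,
    Function.update_idem, Function.update_idem, Function.update_self, Function.update_self,
    jwSign_update_of_le le_rfl, jwSign_update_of_le le_rfl]
  cases h : y i
  · simp only [if_true, ← mul_assoc, jwSign_mul_self, one_mul, Bool.false_eq_true, if_false]
    rw [← h, Function.update_eq_self]; simp
  · simp only [if_true, ← mul_assoc, jwSign_mul_self, one_mul, Bool.true_eq_false, if_false]
    rw [← h, Function.update_eq_self]; simp

theorem ann_mul_cre_of_ne {n : ℕ} {i j : Fin n} (hij : i ≠ j) :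
    (ann i * cre j : Op n) = -(cre j * ann i) := by
  ext x y
  have e1 : ∀ k x y, (ann k : Op n) x y = ((1 : Op n) * ann k) x y := by simp
  have e2 : ∀ k x y, (cre k : Op n) x y = ((1 : Op n) * cre k) x y := by simp
  rw [Matrix.neg_apply, mul_ann_apply, mul_cre_apply, e1 i, e2 j, mul_cre_apply, mul_ann_apply,
    Function.update_of_ne hij, Function.update_of_ne hij.symm, Function.update_comm hij]
  by_cases hi : y i = true
  · by_cases hj : y j = false
    · rcases hij.lt_or_gt with h | h
      · rw [jwSign_update_of_le h.le, jwSign_update_false h hi]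
        simp only [hi, hj, if_true]
        ring
      · rw [jwSign_update_of_le h.le, jwSign_update_true h hj]
        simp only [hi, hj, if_true]
        ring
    · simp [hj]
  · simp [hi]

theorem ann_mul_cre {n : ℕ} (i j : Fin n) :
    (ann i * cre j : Op n) = (if i = j then 1 else 0) - cre j * ann i := by
  split_ifs with h
  · subst h; exact ann_mul_cre_self i
  · rw [ann_mul_cre_of_ne h, zero_sub]

/-! ### The Fock unitary: intertwining relations and unitarity. -/

/-- An operator which intertwines the creation operators with some family of operators vanishes
as soon as it annihilates the vacuum. -/
theorem eq_zero_of_mul_cre {n : ℕ} {X : Op n} (Y : Fin n → Op n)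
    (h : ∀ i, X * cre i = Y i * X) (h0 : ∀ x, X x (vac n) = 0) : X = 0 := by
  have key : ∀ (m : ℕ) (y : Occ n), (Finset.univ.filter fun i => y i = true).card = m →
      ∀ x, X x y = 0 := by
    intro m
    induction m with
    | zero =>
      intro y hy x
      have : y = vac n := by
        funext i
        have := Finset.filter_eq_empty_iff.mp (Finset.card_eq_zero.mp hy) (Finset.mem_univ i)
        simpa [vac] using this
      rw [this, h0]
    | succ m ih =>
      intro y hy x
      obtain ⟨j, hj⟩ := Finset.card_pos.mp (by rw [hy]; exact m.succ_pos)
      have hyj : y j = true := by simpa using hj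
      have hz : (Finset.univ.filter fun i => Function.update y j false i = true).card = m := by
        have : (Finset.univ.filter fun i => Function.update y j false i = true) =
            (Finset.univ.filter fun i => y i = true).erase j := by
          ext i
          by_cases hi : i = j
          · subst hi; simp
          · simp [hi]
        rw [this, Finset.card_erase_of_mem hj, hy, Nat.add_sub_cancel]
      -- Up to sign, column `y` of `X` is column `y - e_j` of `X * cre j = Y j * X`, and that
      -- vanishes because `y - e_j` has one particle fewer.
      have h1 := congrFun (congrFun (h j) x) (Function.update y j false)
      rw [mul_cre_apply, Function.update_self, if_pos rfl, Function.update_idem, Matrix.mul_apply,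
        Finset.sum_eq_zero (fun w _ => by rw [ih _ hz, mul_zero]), ← hyj,
        Function.update_eq_self] at h1
      exact (mul_eq_zero.mp h1).resolve_left (jwSign_ne_zero _ _)
  ext x y
  exact key _ y rfl x

theorem jwSign_eq_prod {n : ℕ} (j : Fin n) (y : Occ n) :
    jwSign j y = ((List.finRange n).map fun i => if i < j ∧ y i = true then (-1 : ℂ) else 1).prod := by
  rw [← Fin.prod_univ_def, Finset.prod_ite]
  simp [jwSign]

/-- Moving `b j` to its slot passes the occupied factors below `j` and collects the Jordan–Wigner
sign; if the slot is already filled, `b j * b j = 0` kills the product. So any anticommuting family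
acts on ordered products as `cre j` acts on Fock basis vectors. A general increasing list makes the
induction possible. -/
theorem mul_prod_of_anticomm {n : ℕ} {b : Fin n → Op n} (hb : ∀ i j, b i * b j = -(b j * b i))
    (j : Fin n) (y : Occ n) (l : List (Fin n)) (hl : l.Pairwise (· < ·)) (hj : j ∈ l) :
    b j * (l.map fun i => if y i = true then b i else 1).prod =
      if y j = false then (l.map fun i => if i < j ∧ y i = true then (-1 : ℂ) else 1).prod •
        (l.map fun i => if Function.update y j true i = true then b i else 1).prod else 0 := by
  induction l with
  | nil => simp at hj
  | cons a l ih =>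
    rw [List.pairwise_cons] at hl
    simp only [List.map_cons, List.prod_cons]
    by_cases ha : a = j
    · subst ha
      have h1 : (l.map fun i => if i < a ∧ y i = true then (-1 : ℂ) else 1) = l.map fun _ => 1 :=
        List.map_congr_left fun i hi => if_neg fun h => (hl.1 i hi).not_gt h.1
      have h2 : (l.map fun i => if Function.update y a true i = true then b i else 1) =
          l.map fun i => if y i = true then b i else 1 :=
        List.map_congr_left fun i hi => by rw [Function.update_of_ne (hl.1 i hi).ne']
      have h3 : b a * b a = 0 := by
        ext x z
        exact self_eq_neg.mp (congrFun (congrFun (hb a a) x) z)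
      rw [h1, h2]
      cases h : y a
      · simp
      · simp [← mul_assoc, h3]
    · have hjl : j ∈ l := (List.mem_cons.mp hj).resolve_left (Ne.symm ha)
      have haj : a < j := hl.1 j hjl
      have ih := ih hl.2 hjl
      have h1 : b j * (if y a = true then b a else 1) =
          (if a < j ∧ y a = true then (-1 : ℂ) else 1) • ((if y a = true then b a else 1) * b j) := by
        cases h : y a
        · simp
        · simp [haj, hb j a]
      rw [← mul_assoc, h1, smul_mul_assoc, mul_assoc, ih, Function.update_of_ne ha]
      split_ifs <;> simp

/-- The creation operators of the modes rotated by `u`. -/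
noncomputable def modeCre {n : ℕ} (u : Matrix (Fin n) (Fin n) ℂ) (j : Fin n) : Op n :=
  ∑ k, star (u j k) • cre k

theorem modeCre_mul_modeCre {n : ℕ} (u : Matrix (Fin n) (Fin n) ℂ) (i j : Fin n) :
    modeCre u i * modeCre u j = -(modeCre u j * modeCre u i) := by
  simp only [modeCre, Finset.sum_mul_sum, smul_mul_smul_comm]
  rw [Finset.sum_comm, ← Finset.sum_neg_distrib]
  refine Finset.sum_congr rfl fun k _ => ?_
  rw [← Finset.sum_neg_distrib]
  refine Finset.sum_congr rfl fun l _ => ?_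
  rw [cre_mul_cre, smul_neg, mul_comm]

theorem conjTranspose_modeCre {n : ℕ} (u : Matrix (Fin n) (Fin n) ℂ) (j : Fin n) :
    (modeCre u j).conjTranspose = ∑ k, u j k • ann k := by
  simp [modeCre, Matrix.conjTranspose_sum, Matrix.conjTranspose_smul, cre]

theorem conjTranspose_modeCre_mul {n : ℕ} {u : Matrix (Fin n) (Fin n) ℂ}
    (hu : u ∈ Matrix.unitaryGroup (Fin n) ℂ) (i j : Fin n) :
    (modeCre u i).conjTranspose * modeCre u j =
      (if i = j then 1 else 0) - modeCre u j * (modeCre u i).conjTranspose := by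
  have h : ∑ k, u i k * star (u j k) = if i = j then 1 else 0 := by
    have := congrFun (congrFun (Matrix.mem_unitaryGroup_iff.mp hu) i) j
    rwa [Matrix.mul_apply, Matrix.one_apply] at this
  have h' : (if i = j then 1 else 0 : Op n) = (if i = j then 1 else 0 : ℂ) • 1 := by
    split_ifs <;> simp
  rw [conjTranspose_modeCre, modeCre, Finset.sum_mul_sum, Finset.sum_mul_sum, h', ← h,
    Finset.sum_smul, Finset.sum_comm (s := Finset.univ (α := Fin n)) (t := Finset.univ)
      (f := fun x y => star (u j x) • cre x * u i y • ann y), ← Finset.sum_sub_distrib]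
  refine Finset.sum_congr rfl fun k _ => ?_
  have h2 : (u i k * star (u j k)) • (1 : Op n) =
      ∑ l, (u i k * star (u j l)) • (if k = l then 1 else 0 : Op n) := by
    simp
  rw [h2, ← Finset.sum_sub_distrib]
  refine Finset.sum_congr rfl fun l _ => ?_
  rw [smul_mul_smul_comm, smul_mul_smul_comm, ann_mul_cre, smul_sub, mul_comm (star (u j l))]

theorem fockU_apply_eq {n : ℕ} (u : Matrix (Fin n) (Fin n) ℂ) (x y : Occ n) :
    fockU u x y =
      ((List.finRange n).map fun j => if y j = true then modeCre u j else 1).prod x (vac n) := by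
  rw [fockU, Matrix.of_apply, List.ofFn_eq_map]; rfl

/-- The columns of `fockU u` are ordered products of rotated creation operators on the vacuum, and
these operators anticommute for every matrix `u`; unitarity enters only with the annihilation
operators. -/
theorem fockU_mul_cre {n : ℕ} (u : Matrix (Fin n) (Fin n) ℂ) (j : Fin n) :
    fockU u * cre j = modeCre u j * fockU u := by
  ext x y
  have h : (modeCre u j * fockU u) x y =
      (modeCre u j * ((List.finRange n).map fun j =>
        if y j = true then modeCre u j else 1).prod) x (vac n) := by
    simp only [Matrix.mul_apply, fockU_apply_eq]
  rw [h, mul_cre_apply, mul_prod_of_anticomm (modeCre_mul_modeCre u) j y _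
    (List.pairwise_lt_finRange n) (List.mem_finRange j), ← jwSign_eq_prod, fockU_apply_eq]
  split_ifs <;> simp

theorem fockU_vac {n : ℕ} (u : Matrix (Fin n) (Fin n) ℂ) (x : Occ n) :
    fockU u x (vac n) = if x = vac n then 1 else 0 := by
  rw [fockU_apply_eq]
  simp [vac, Matrix.one_apply]

theorem ann_apply_vac {n : ℕ} (j : Fin n) (x : Occ n) : (ann j : Op n) x (vac n) = 0 := by
  simp [ann, vac]

/-- The difference of the two sides kills the vacuum. The contractions δ_ij from the two
anticommutation relations cancel, so it intertwines `cre i` with `-modeCre u i`, hence is zero. -/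
theorem fockU_mul_ann {n : ℕ} {u : Matrix (Fin n) (Fin n) ℂ}
    (hu : u ∈ Matrix.unitaryGroup (Fin n) ℂ) (j : Fin n) :
    fockU u * ann j = (modeCre u j).conjTranspose * fockU u := by
  rw [eq_comm, ← sub_eq_zero]
  refine eq_zero_of_mul_cre (fun i => -modeCre u i) (fun i => ?_) fun x => ?_
  · rw [sub_mul, mul_assoc, fockU_mul_cre, ← mul_assoc, conjTranspose_modeCre_mul hu, mul_assoc,
      ann_mul_cre, mul_sub, ← mul_assoc (fockU u), fockU_mul_cre, neg_mul, mul_sub, sub_mul]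
    split_ifs <;> noncomm_ring
  · have h1 : ((modeCre u j).conjTranspose * fockU u) x (vac n) = 0 := by
      rw [Matrix.mul_apply, Finset.sum_eq_single (vac n)]
      · rw [conjTranspose_modeCre, Matrix.sum_apply]
        simp [ann_apply_vac]
      · intro w _ hw; rw [fockU_vac, if_neg hw, mul_zero]
      · simp
    have h2 : (fockU u * ann j) x (vac n) = 0 := by
      rw [mul_ann_apply]; simp [vac]
    rw [Matrix.sub_apply, h1, h2, sub_zero]

/-- U†U commutes with all creation operators, so it suffices to see that it fixes the vacuum. It
also commutes with each `ann j`, hence every `ann j` kills U†U|0⟩, which leaves only a vacuum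
component, equal to 1. -/
theorem conjTranspose_fockU_mul_fockU {n : ℕ} {u : Matrix (Fin n) (Fin n) ℂ}
    (hu : u ∈ Matrix.unitaryGroup (Fin n) ℂ) : (fockU u).conjTranspose * fockU u = 1 := by
  have hc : ∀ i, (fockU u).conjTranspose * modeCre u i = cre i * (fockU u).conjTranspose := by
    intro i
    have := congrArg Matrix.conjTranspose (fockU_mul_ann hu i)
    rw [Matrix.conjTranspose_mul, Matrix.conjTranspose_mul, Matrix.conjTranspose_conjTranspose] at this
    exact this.symm
  have ha : ∀ i, (fockU u).conjTranspose * (modeCre u i).conjTranspose =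
      ann i * (fockU u).conjTranspose := by
    intro i
    have := congrArg Matrix.conjTranspose (fockU_mul_cre u i)
    rw [Matrix.conjTranspose_mul, Matrix.conjTranspose_mul, cre, Matrix.conjTranspose_conjTranspose]
      at this
    exact this.symm
  rw [← sub_eq_zero]
  refine eq_zero_of_mul_cre cre (fun i => ?_) fun x => ?_
  · rw [sub_mul, mul_assoc, fockU_mul_cre, ← mul_assoc, hc, mul_sub, mul_assoc]
    simp
  · rw [Matrix.sub_apply, sub_eq_zero, Matrix.one_apply]
    by_cases hx : x = vac n
    · rw [hx, if_pos rfl, Matrix.mul_apply, Finset.sum_eq_single (vac n)]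
      · simp [fockU_vac]
      · intro w _ hw; rw [fockU_vac, if_neg hw, mul_zero]
      · simp
    · rw [if_neg hx]
      obtain ⟨j, hj⟩ := Function.ne_iff.mp hx
      have hxj : x j = true := by simpa [vac] using hj
      have h1 : ann j * ((fockU u).conjTranspose * fockU u) =
          (fockU u).conjTranspose * fockU u * ann j := by
        rw [mul_assoc, fockU_mul_ann hu, ← mul_assoc, ← mul_assoc, ha]
      have h2 := congrFun (congrFun h1 (Function.update x j false)) (vac n)
      rw [ann_mul_apply, mul_ann_apply, Function.update_self, if_pos rfl, Function.update_idem,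
        if_neg (by simp [vac])] at h2
      rw [← hxj, Function.update_eq_self] at h2
      exact (mul_eq_zero.mp h2).resolve_left (jwSign_ne_zero _ _)

theorem fockU_mul_conjTranspose_fockU {n : ℕ} {u : Matrix (Fin n) (Fin n) ℂ}
    (hu : u ∈ Matrix.unitaryGroup (Fin n) ℂ) : fockU u * (fockU u).conjTranspose = 1 :=
  mul_eq_one_comm.mp (conjTranspose_fockU_mul_fockU hu)

theorem fockU_conj_cre {n : ℕ} {u : Matrix (Fin n) (Fin n) ℂ}
    (hu : u ∈ Matrix.unitaryGroup (Fin n) ℂ) (j : Fin n) :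
    fockU u * cre j * (fockU u).conjTranspose = ∑ k, star (u j k) • cre k := by
  rw [fockU_mul_cre, mul_assoc, fockU_mul_conjTranspose_fockU hu, mul_one, modeCre]

theorem conjTranspose_fockU_conj_cre {n : ℕ} {u : Matrix (Fin n) (Fin n) ℂ}
    (hu : u ∈ Matrix.unitaryGroup (Fin n) ℂ) (k : Fin n) :
    (fockU u).conjTranspose * cre k * fockU u = ∑ j, u j k • cre j := by
  have h : (cre k : Op n) = ∑ j, u j k • modeCre u j := by
    have hk : ∀ l, ∑ j, u j k * star (u j l) = if l = k then 1 else 0 := by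
      intro l
      have := congrFun (congrFun (Matrix.mem_unitaryGroup_iff'.mp hu) l) k
      rw [Matrix.mul_apply, Matrix.one_apply] at this
      rw [← this]
      exact Finset.sum_congr rfl fun j _ => by rw [mul_comm]; rfl
    simp only [modeCre, Finset.smul_sum, smul_smul]
    rw [Finset.sum_comm]
    simp only [← Finset.sum_smul, hk]
    simp
  have hj : ∀ j, (fockU u).conjTranspose * modeCre u j * fockU u = cre j := by
    intro j
    rw [mul_assoc, ← fockU_mul_cre, ← mul_assoc, conjTranspose_fockU_mul_fockU hu, one_mul]
  rw [h, Finset.mul_sum, Finset.sum_mul]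
  refine Finset.sum_congr rfl fun j _ => ?_
  rw [mul_smul_comm, smul_mul_assoc, hj]

/-! ### Invariance of the 2k-point space under rotations, dephasing and the channel. -/

theorem span_range_pow {R A ι : Type*} [CommSemiring R] [Semiring A] [Algebra R A] (f : ι → A)
    (k : ℕ) : Submodule.span R (Set.range f) ^ k =
      Submodule.span R (Set.range fun i : Fin k → ι => (List.ofFn fun r => f (i r)).prod) := by
  rw [Submodule.span_pow]
  congr 1
  ext a
  rw [Set.mem_pow]
  constructor
  · rintro ⟨g, rfl⟩
    choose i hi using fun r => (g r).2
    exact ⟨i, by simp only [hi]⟩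
  · rintro ⟨i, rfl⟩
    exact ⟨fun r => ⟨f (i r), i r, rfl⟩, rfl⟩

/-- As a product of powers of two submodules, the space is mapped into itself by any algebra
homomorphism that preserves the span of the `cre j` and the span of the `ann j`. -/
theorem twoKPointSpace_eq_mul (n k : ℕ) : twoKPointSpace n k =
    Submodule.span ℂ (Set.range (cre : Fin n → Op n)) ^ k *
      Submodule.span ℂ (Set.range (ann : Fin n → Op n)) ^ k := by
  rw [span_range_pow, span_range_pow, Submodule.span_mul_span, twoKPointSpace]
  congr 1
  ext a
  rw [Set.mem_mul]
  constructor
  · rintro ⟨p, rfl⟩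
    exact ⟨_, ⟨p.1, rfl⟩, _, ⟨p.2, rfl⟩, rfl⟩
  · rintro ⟨_, ⟨i, rfl⟩, _, ⟨j, rfl⟩, rfl⟩
    exact ⟨(i, j), rfl⟩

/-- Conjugation by a unitary which maps creation operators to combinations of creation operators
preserves the `2k`-point space. -/
theorem conj_mem_twoKPointSpace {n k : ℕ} {V : Op n} (h : V.conjTranspose * V = 1)
    (m : Fin n → Fin n → ℂ) (hc : ∀ k, V * cre k * V.conjTranspose = ∑ j, m k j • cre j)
    {A : Op n} (hA : A ∈ twoKPointSpace n k) :
    V * A * V.conjTranspose ∈ twoKPointSpace n k := by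
  have h' : V * V.conjTranspose = 1 := mul_eq_one_comm.mp h
  let φ : Op n →ₐ[ℂ] Op n := AlgHom.ofLinearMap
    (LinearMap.mulRight ℂ V.conjTranspose ∘ₗ LinearMap.mulLeft ℂ V) (by simp [h']) (by
      intro A B
      simp only [LinearMap.comp_apply, LinearMap.mulLeft_apply, LinearMap.mulRight_apply]
      calc V * (A * B) * V.conjTranspose = V * A * 1 * B * V.conjTranspose := by
            rw [mul_one, mul_assoc V A B]
        _ = _ := by rw [← h]; simp only [mul_assoc])
  have hφ : ∀ A, φ A = V * A * V.conjTranspose := fun A => rfl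
  have h1 : (Submodule.span ℂ (Set.range (cre : Fin n → Op n))).map φ.toLinearMap ≤
      Submodule.span ℂ (Set.range cre) := by
    rw [Submodule.map_span, Submodule.span_le]
    rintro _ ⟨_, ⟨j, rfl⟩, rfl⟩
    rw [AlgHom.toLinearMap_apply, hφ, hc]
    exact Submodule.sum_mem _ fun i _ => Submodule.smul_mem _ _ (Submodule.subset_span ⟨i, rfl⟩)
  have h2 : (Submodule.span ℂ (Set.range (ann : Fin n → Op n))).map φ.toLinearMap ≤
      Submodule.span ℂ (Set.range ann) := by
    rw [Submodule.map_span, Submodule.span_le]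
    rintro _ ⟨_, ⟨j, rfl⟩, rfl⟩
    have e : V * ann j * V.conjTranspose = ∑ i, star (m j i) • ann i := by
      have := congrArg Matrix.conjTranspose (hc j)
      simpa [Matrix.conjTranspose_mul, Matrix.conjTranspose_sum, cre, mul_assoc] using this
    rw [AlgHom.toLinearMap_apply, hφ, e]
    exact Submodule.sum_mem _ fun i _ => Submodule.smul_mem _ _ (Submodule.subset_span ⟨i, rfl⟩)
  have h3 : (twoKPointSpace n k).map φ.toLinearMap ≤ twoKPointSpace n k := by
    rw [twoKPointSpace_eq_mul, Submodule.map_mul, Submodule.map_pow, Submodule.map_pow]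
    exact mul_le_mul' (pow_le_pow_left' h1 k) (pow_le_pow_left' h2 k)
  exact h3 ⟨A, hA, rfl⟩

theorem prod_map_perm_of_anticomm {R ι : Type*} [Ring R] {b : ι → R}
    (hb : ∀ i j, b i * b j = -(b j * b i)) {l l' : List ι} (h : l.Perm l') :
    (l.map b).prod = (l'.map b).prod ∨ (l.map b).prod = -(l'.map b).prod := by
  induction h with
  | nil => simp
  | cons a _ ih =>
    rcases ih with h | h
    · left; simp [h]
    · right; simp [h]
  | swap a c l =>
    right
    simp only [List.map_cons, List.prod_cons]
    rw [← mul_assoc, hb, neg_mul, mul_assoc]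
  | trans _ _ ih1 ih2 =>
    rcases ih1 with h | h <;> rcases ih2 with h' | h' <;> simp [h, h']

/-- A repeated index can be brought next to its copy, where the square vanishes; distinct indices
can be sorted at the cost of a sign. -/
theorem prod_ofFn_of_anticomm {R : Type*} [Ring R] {n k : ℕ} {b : Fin n → R}
    (hb : ∀ i j, b i * b j = -(b j * b i)) (hb0 : ∀ i, b i * b i = 0) (i : Fin k → Fin n) :
    (List.ofFn fun r => b (i r)).prod = 0 ∨ ∃ j : Fin k ↪o Fin n,
      (List.ofFn fun r => b (i r)).prod = (List.ofFn fun r => b (j r)).prod ∨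
      (List.ofFn fun r => b (i r)).prod = -(List.ofFn fun r => b (j r)).prod := by
  have e : ∀ i : Fin k → Fin n, (List.ofFn fun r => b (i r)) = (List.ofFn i).map b := by
    intro i; rw [List.map_ofFn]; rfl
  by_cases hi : Function.Injective i
  · right
    have hcard : (Finset.univ.image i).card = k := by
      rw [Finset.card_image_of_injective _ hi]; simp
    refine ⟨(Finset.univ.image i).orderEmbOfFin hcard, ?_⟩
    rw [e, e]
    refine prod_map_perm_of_anticomm hb ?_
    rw [List.perm_ext_iff_of_nodup (List.nodup_ofFn.mpr hi)
      (List.nodup_ofFn.mpr (RelEmbedding.injective _))]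
    intro a
    rw [List.mem_ofFn, List.mem_ofFn, ← Set.mem_range, ← Set.mem_range,
      Finset.range_orderEmbOfFin]
    simp
  · left
    rw [e]
    have hd : ¬ (List.ofFn i).Nodup := fun h => hi (List.nodup_ofFn.mp h)
    obtain ⟨a, ha⟩ : ∃ a, List.Duplicate a (List.ofFn i) := by
      by_contra hcon
      push Not at hcon
      exact hd (List.nodup_iff_forall_not_duplicate.mpr hcon)
    obtain ⟨l', h'⟩ := (List.duplicate_iff_sublist.mp ha).exists_perm_append
    have h0 : (([a, a] ++ l').map b).prod = 0 := by simp [← mul_assoc, hb0]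
    rcases prod_map_perm_of_anticomm hb h' with h | h <;> rw [h, h0]
    exact neg_zero

theorem ann_mul_self {n : ℕ} (i : Fin n) : (ann i * ann i : Op n) = 0 := by
  ext x y
  exact self_eq_neg.mp (congrFun (congrFun (ann_mul_ann i i) x) y)

theorem cre_mul_self {n : ℕ} (i : Fin n) : (cre i * cre i : Op n) = 0 := by
  rw [cre, ← Matrix.conjTranspose_mul, ann_mul_self, Matrix.conjTranspose_zero]

theorem twoKPointSpace_eq_span_basisOp (n k : ℕ) :
    twoKPointSpace n k = Submodule.span ℂ (Set.range (basisOp : Idx n k → Op n)) := by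
  refine le_antisymm (Submodule.span_le.mpr ?_) (Submodule.span_mono ?_)
  · rintro _ ⟨⟨i, j⟩, rfl⟩
    have hm : ∀ l : Idx n k, corr l.1 l.2 ∈
      Submodule.span ℂ (Set.range (basisOp : Idx n k → Op n)) :=
        fun l => Submodule.subset_span ⟨l, rfl⟩
    rcases prod_ofFn_of_anticomm cre_mul_cre cre_mul_self i with hi | ⟨i', hi⟩
    · simp [corr, hi]
    rcases prod_ofFn_of_anticomm ann_mul_ann ann_mul_self j with hj | ⟨j', hj⟩
    · simp [corr, hj]
    have hij := hm (i', j')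
    rcases hi with hi | hi <;> rcases hj with hj | hj <;>
      simpa [corr, hi, hj] using hij
  · rintro _ ⟨l, rfl⟩
    exact ⟨(⇑l.1, ⇑l.2), rfl⟩

theorem emptied_injOn {n : ℕ} {l : List (Fin n)} {x y : Occ n} (hx : ∀ i ∈ l, x i = true)
    (hy : ∀ i ∈ l, y i = true) (h : emptied l x = emptied l y) : x = y := by
  funext i
  by_cases hi : i ∈ l
  · rw [hx i hi, hy i hi]
  · simpa [emptied, hi] using congrFun h i

/-- For equal creation and annihilation tuples the operator is already diagonal. Otherwise it
changes the set of occupied modes, so its diagonal is zero. -/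
theorem diagonal_basisOp_mem {n k : ℕ} (l : Idx n k) :
    Matrix.diagonal (fun x => (basisOp l : Op n) x x) ∈ twoKPointSpace n k := by
  obtain ⟨s, -, h⟩ := corr_apply l
  by_cases hl : l.1 = l.2
  · have : Matrix.diagonal (fun x => (basisOp l : Op n) x x) = basisOp l := by
      ext x y
      rw [Matrix.diagonal_apply]
      split_ifs with hxy
      · rw [hxy]
      · rw [h, if_neg]
        rintro ⟨h1, h2, h3⟩
        rw [← hl] at h2 h3
        exact hxy (emptied_injOn (by simpa using h1) (by simpa using h2) h3)
    rw [this]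
    exact Submodule.subset_span ⟨(⇑l.1, ⇑l.2), rfl⟩
  · have : Matrix.diagonal (fun x => (basisOp l : Op n) x x) = 0 := by
      rw [Matrix.diagonal_eq_zero]
      funext x
      rw [h, if_neg, Pi.zero_apply]
      rintro ⟨h1, h2, h3⟩
      refine hl (OrderEmbedding.range_inj.mp ?_)
      ext i
      have h4 := congrFun h3 i
      simp only [emptied, List.mem_ofFn, ← Set.mem_range] at h4
      constructor
      · intro hi
        by_contra hj
        obtain ⟨r, rfl⟩ := hi
        rw [if_pos ⟨r, rfl⟩, if_neg hj, h1] at h4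
        simp at h4
      · intro hi
        by_contra hj
        obtain ⟨r, rfl⟩ := hi
        rw [if_neg hj, if_pos ⟨r, rfl⟩, h2] at h4
        simp at h4
    rw [this]
    exact Submodule.zero_mem _

theorem diagonal_mem {n k : ℕ} {A : Op n} (hA : A ∈ twoKPointSpace n k) :
    Matrix.diagonal (fun x => A x x) ∈ twoKPointSpace n k := by
  have hle : twoKPointSpace n k ≤ (twoKPointSpace n k).comap
      (Matrix.diagonalLinearMap (Occ n) ℂ ℂ ∘ₗ Matrix.diagLinearMap (Occ n) ℂ ℂ) := by
    conv_lhs => rw [twoKPointSpace_eq_span_basisOp]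
    rw [Submodule.span_le]
    rintro _ ⟨l, rfl⟩
    exact diagonal_basisOp_mem l
  exact hle hA

theorem shot_eq {n : ℕ} (u : Matrix (Fin n) (Fin n) ℂ) (A : Op n) : shot u A =
    (fockU u).conjTranspose *
      Matrix.diagonal (fun x => (fockU u * A * (fockU u).conjTranspose) x x) * fockU u := by
  rw [shot, ← Matrix.sum_single_eq_diagonal, Finset.mul_sum, Finset.sum_mul]
  refine Finset.sum_congr rfl fun x _ => ?_
  rw [← smul_mul_assoc, ← mul_smul_comm, Matrix.smul_single, smul_eq_mul, mul_one]

/-- By `shot_eq` a shot is a rotation, a projection onto the diagonal and the inverse rotation, each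
of which preserves the space. -/
theorem shot_mem {n k : ℕ} {u : Matrix (Fin n) (Fin n) ℂ}
    (hu : u ∈ Matrix.unitaryGroup (Fin n) ℂ) {A : Op n} (hA : A ∈ twoKPointSpace n k) :
    shot u A ∈ twoKPointSpace n k := by
  rw [shot_eq]
  have h1 := diagonal_mem (conj_mem_twoKPointSpace (conjTranspose_fockU_mul_fockU hu)
    (fun j k => star (u j k)) (fockU_conj_cre hu) hA)
  have h2 := conj_mem_twoKPointSpace (V := (fockU u).conjTranspose)
    (by rw [Matrix.conjTranspose_conjTranspose, fockU_mul_conjTranspose_fockU hu])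
    (fun k j => u j k)
    (by rw [Matrix.conjTranspose_conjTranspose]; exact conjTranspose_fockU_conj_cre hu) h1
  rwa [Matrix.conjTranspose_conjTranspose] at h2

/-- Linear functionals commute with the average over the ensemble. -/
theorem map_channel {n : ℕ} (ν : Measure (ModeUnitary n)) [IsProbabilityMeasure ν] (A : Op n)
    (f : Op n →ₗ[ℂ] ℂ) :
    f (channel ν A) = ∫ u : ModeUnitary n, f (shot (u : Matrix (Fin n) (Fin n) ℂ) A) ∂ν := by
  have hf : ∀ X : Op n, f X = ∑ p, ∑ q, X p q * f (Matrix.single p q 1) := by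
    intro X
    conv_lhs => rw [Matrix.matrix_eq_sum_single X]
    simp only [map_sum]
    refine Finset.sum_congr rfl fun p _ => Finset.sum_congr rfl fun q _ => ?_
    rw [← smul_eq_mul, ← map_smul, Matrix.smul_single, smul_eq_mul, mul_one]
  simp only [hf (shot _ _)]
  rw [integral_finsetSum _ fun p _ => integrable_finsetSum _ fun q _ =>
    (integrable_shot ν A p q).mul_const _, hf]
  refine Finset.sum_congr rfl fun p _ => ?_
  rw [integral_finsetSum _ fun q _ => (integrable_shot ν A p q).mul_const _]
  refine Finset.sum_congr rfl fun q _ => ?_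
  rw [integral_mul_const]
  rfl

/-- The average is defined entrywise, so membership is tested by duality: a functional that vanishes
on the subspace vanishes on every shot, hence on the average. -/
theorem channel_mem {n k : ℕ} (ν : Measure (ModeUnitary n)) [IsProbabilityMeasure ν] {A : Op n}
    (hA : A ∈ twoKPointSpace n k) : channel ν A ∈ twoKPointSpace n k := by
  by_contra h
  obtain ⟨f, hf, hle⟩ := Submodule.exists_le_ker_of_notMem h
  refine hf ?_
  rw [map_channel]
  simp only [show ∀ u : ModeUnitary n, f (shot (u : Matrix (Fin n) (Fin n) ℂ) A) = 0 from
    fun u => hle (shot_mem u.2 hA), integral_zero]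

/-! ### Self-adjointness of the channel and coordinates of its pseudo-inverse. -/

theorem trace_mul_shot {n : ℕ} (u : Matrix (Fin n) (Fin n) ℂ) (A B : Op n) :
    (B * shot u A).trace = ∑ x, (fockU u * A * (fockU u).conjTranspose) x x *
      (fockU u * B * (fockU u).conjTranspose) x x := by
  rw [shot_eq, ← mul_assoc, Matrix.trace_mul_comm, ← mul_assoc, ← mul_assoc, Matrix.trace]
  refine Finset.sum_congr rfl fun x _ => ?_
  rw [Matrix.diag_apply, Matrix.mul_diagonal, mul_comm]

/-- The integrand is the Hermitian pairing of the diagonals of UAU† and UBU†. Exchanging `A` and `B`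
conjugates it, which gives `channel_symm`. -/
theorem hs_channel {n : ℕ} (ν : Measure (ModeUnitary n)) [IsProbabilityMeasure ν] (A B : Op n) :
    hs A (channel ν B) = ∫ u : ModeUnitary n, ∑ x,
      (fockU (u : Matrix (Fin n) (Fin n) ℂ) * B * (fockU (u : Matrix (Fin n) (Fin n) ℂ)).conjTranspose) x x *
      star ((fockU (u : Matrix (Fin n) (Fin n) ℂ) * A *
        (fockU (u : Matrix (Fin n) (Fin n) ℂ)).conjTranspose) x x) ∂ν := by
  have h := map_channel ν B (Matrix.traceLinearMap (Occ n) ℂ ℂ ∘ₗ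
    LinearMap.mulLeft ℂ A.conjTranspose)
  simp only [LinearMap.comp_apply, LinearMap.mulLeft_apply, Matrix.traceLinearMap_apply,
    trace_mul_shot] at h
  rw [hs, h]
  simp only [← Matrix.conjTranspose_apply, Matrix.conjTranspose_mul,
    Matrix.conjTranspose_conjTranspose, mul_assoc]

theorem hs_conj_symm {n : ℕ} (A B : Op n) : hs A B = star (hs B A) := by
  rw [hs, hs, ← Matrix.trace_conjTranspose, Matrix.conjTranspose_mul,
    Matrix.conjTranspose_conjTranspose]

theorem channel_symm {n : ℕ} (ν : Measure (ModeUnitary n)) [IsProbabilityMeasure ν] (A B : Op n) :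
    hs (channel ν A) B = hs A (channel ν B) := by
  rw [hs_conj_symm, hs_channel, hs_channel, ← starRingEnd_apply, ← integral_conj]
  congr 1
  funext u
  rw [map_sum]
  refine Finset.sum_congr rfl fun x _ => ?_
  rw [map_mul, starRingEnd_apply, starRingEnd_apply, star_star, mul_comm]

theorem hs_ext {n : ℕ} {X Y : Op n} (h : ∀ B, hs X B = hs Y B) : X = Y := by
  have h2 : ((X - Y).conjTranspose * (X - Y)).trace = 0 := by
    simpa [hs, Matrix.sub_mul, sub_eq_zero] using h (X - Y)
  exact sub_eq_zero.mp (Matrix.trace_conjTranspose_mul_self_eq_zero_iff.mp h2)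

/-- The pseudo-inverse of a symmetric map preserves every subspace which the map preserves. -/
theorem IsMoorePenrose.map_mem {n : ℕ} {T P : Op n →ₗ[ℂ] Op n} (hP : IsMoorePenrose T P)
    (hT : ∀ A B, hs (T A) B = hs A (T B)) {W : Submodule ℂ (Op n)} (hW : ∀ A ∈ W, T A ∈ W)
    {A : Op n} (hA : A ∈ W) : P A ∈ W := by
  have h1 : ∀ X, P (T (T X)) = T X := fun X => hs_ext fun B => by
    rw [hP.inv_map_symm, hT, hP.map_inv_map, ← hT]
  have h2 : ∀ X, T X = 0 → P X = 0 := by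
    intro X hX
    have : T (P X) = 0 := hs_ext fun B => by
      rw [hP.map_inv_symm, ← hT, hX]; simp [hs]
    rw [← hP.inv_map_inv, this, map_zero]
  have h3 : ∀ X, T (T X) = 0 → T X = 0 := by
    intro X hX
    rw [← h1, hX, map_zero]
  let S : W →ₗ[ℂ] W := T.restrict hW
  have hS : ∀ w : W, (S w : Op n) = T w := fun w => rfl
  -- Self-adjointness gives ker T² = ker T. Restricted to `W`, with rank–nullity, it yields W =
  -- range S² ⊕ ker S. On this decomposition `P` is explicit: P(T(T w)) = T w, and `P` kills ker T.
  have hker : LinearMap.ker (S ∘ₗ S) = LinearMap.ker S := by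
    ext w
    rw [LinearMap.mem_ker, LinearMap.mem_ker, LinearMap.comp_apply, ← Subtype.coe_inj,
      ← Subtype.coe_inj, hS, hS]
    exact ⟨h3 _, fun h => by rw [h]; simp⟩
  have hdisj : Disjoint (LinearMap.range (S ∘ₗ S)) (LinearMap.ker S) := by
    rw [Submodule.disjoint_def]
    rintro _ ⟨w, rfl⟩ hw
    rw [LinearMap.mem_ker, ← Subtype.coe_inj] at hw
    rw [← Subtype.coe_inj]
    exact h3 _ hw
  have htop : LinearMap.range (S ∘ₗ S) ⊔ LinearMap.ker S = ⊤ :=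
    Submodule.eq_top_of_disjoint _ _ (by
      rw [← hker, LinearMap.finrank_range_add_finrank_ker]) hdisj
  obtain ⟨_, ⟨w, rfl⟩, z, hz, hwz⟩ :=
    Submodule.mem_sup.mp (htop ▸ Submodule.mem_top (x := (⟨A, hA⟩ : W)))
  have hA' : A = T (T w) + z := (congrArg Subtype.val hwz).symm
  rw [LinearMap.mem_ker, ← Subtype.coe_inj] at hz
  rw [hA', map_add, h1, h2 z hz, add_zero]
  exact hW _ w.2

theorem isMoorePenrose_pinv {n : ℕ} (T : Op n →ₗ[ℂ] Op n) : IsMoorePenrose T (pinv T) :=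
  (exists_isMoorePenrose T).choose_spec

theorem pinv_channel_mem {n k : ℕ} (ν : Measure (ModeUnitary n)) [IsProbabilityMeasure ν]
    {A : Op n} (hA : A ∈ twoKPointSpace n k) : pinv (channel ν) A ∈ twoKPointSpace n k :=
  (isMoorePenrose_pinv _).map_mem (channel_symm ν) (fun _ => channel_mem ν) hA

theorem sum_coord {n k : ℕ} {X : Op n} (hX : X ∈ twoKPointSpace n k) :
    ∑ l : Idx n k, coord X l • basisOp l = X := by
  rw [twoKPointSpace_eq_span_basisOp, Submodule.mem_span_range_iff_exists_fun] at hX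
  obtain ⟨c, rfl⟩ := hX
  rw [coord_sum]

/-- `coord` returns 0 outside the 2k-point space, so `pinvCoeff` contains the true matrix elements
only because the pseudo-inverse preserves that space. -/
theorem pinv_channel_eq_sum {n k : ℕ} (ν : Measure (ModeUnitary n)) [IsProbabilityMeasure ν]
    {O : Op n} (hO : O ∈ twoKPointSpace n k) : pinv (channel ν) O =
      ∑ s : Idx n k, (∑ l : Idx n k, pinvCoeff k ν s l * coord O l) • basisOp s := by
  have h : ∀ l : Idx n k, pinv (channel ν) (basisOp l) =
      ∑ s : Idx n k, pinvCoeff k ν s l • basisOp s := fun l =>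
    (sum_coord (pinv_channel_mem ν (Submodule.subset_span ⟨(⇑l.1, ⇑l.2), rfl⟩))).symm
  conv_lhs => rw [← sum_coord hO]
  simp only [map_sum, map_smul, h, Finset.smul_sum, smul_smul, Finset.sum_smul]
  rw [Finset.sum_comm]
  simp only [mul_comm]

/-! ### Operator norm bounds and the bound on one round. -/

section Norm

open scoped Matrix.Norms.L2Operator

theorem norm_apply_le_l2_opNorm {ι : Type*} [Fintype ι] [DecidableEq ι] (A : Matrix ι ι ℂ)
    (i j : ι) : ‖A i j‖ ≤ ‖A‖ := by
  have h := A.l2_opNorm_mulVec (EuclideanSpace.single j 1)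
  rw [PiLp.norm_single, norm_one, mul_one] at h
  refine le_trans ?_ ((PiLp.norm_apply_le _ i).trans h)
  simp

theorem norm_one_le (n : ℕ) : ‖(1 : Op n)‖ ≤ 1 := IsStarProjection.norm_le _ (IsStarProjection.one _)

/-- The number operator a†a is a projection, and the C*-identity gives ‖a‖² = ‖a†a‖ ≤ 1. -/
theorem norm_ann_le {n : ℕ} (j : Fin n) : ‖(ann j : Op n)‖ ≤ 1 := by
  have h : IsStarProjection ((ann j).conjTranspose * ann j : Op n) := by
    refine ⟨?_, ?_⟩
    · have h1 : cre j * ann j * (cre j * ann j) = (cre j * ann j : Op n) := by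
        rw [mul_assoc, ← mul_assoc (ann j), ann_mul_cre_self, sub_mul, mul_sub, mul_assoc,
          ann_mul_self]
        simp
      exact h1
    · exact Matrix.isHermitian_conjTranspose_mul_self _
  have h2 := IsStarProjection.norm_le _ h
  rw [Matrix.l2_opNorm_conjTranspose_mul_self] at h2
  nlinarith [norm_nonneg (ann j : Op n)]

theorem norm_cre_le {n : ℕ} (j : Fin n) : ‖(cre j : Op n)‖ ≤ 1 := by
  rw [cre, Matrix.l2_opNorm_conjTranspose]
  exact norm_ann_le j

theorem norm_list_prod_le_one {n : ℕ} (l : List (Op n)) (h : ∀ A ∈ l, ‖A‖ ≤ 1) :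
    ‖l.prod‖ ≤ 1 := by
  induction l with
  | nil => exact norm_one_le n
  | cons A l ih =>
    rw [List.prod_cons]
    exact (norm_mul_le _ _).trans (mul_le_one₀ (h A (by simp)) (norm_nonneg _)
      (ih fun B hB => h B (by simp [hB])))

theorem norm_corr_le {n k : ℕ} (i j : Fin k → Fin n) : ‖(corr i j : Op n)‖ ≤ 1 := by
  refine (norm_mul_le _ _).trans (mul_le_one₀ ?_ (norm_nonneg _) ?_)
  · refine norm_list_prod_le_one _ fun A hA => ?_
    obtain ⟨r, rfl⟩ := (List.mem_ofFn' _ _).mp hA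
    exact norm_cre_le _
  · refine norm_list_prod_le_one _ fun A hA => ?_
    obtain ⟨r, rfl⟩ := (List.mem_ofFn' _ _).mp hA
    exact norm_ann_le _

theorem norm_fockU_conj_apply_le {n : ℕ} {u : Matrix (Fin n) (Fin n) ℂ}
    (hu : u ∈ Matrix.unitaryGroup (Fin n) ℂ) (A : Op n) (x y : Occ n) :
    ‖(fockU u * A * (fockU u).conjTranspose) x y‖ ≤ ‖A‖ := by
  have h : ‖fockU u‖ ≤ 1 := by
    have h2 := norm_one_le n
    rw [← conjTranspose_fockU_mul_fockU hu, Matrix.l2_opNorm_conjTranspose_mul_self] at h2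
    nlinarith [norm_nonneg (fockU u)]
  have h' : ‖(fockU u).conjTranspose‖ ≤ 1 := by rwa [Matrix.l2_opNorm_conjTranspose]
  refine (norm_apply_le_l2_opNorm _ _ _).trans ((norm_mul_le _ _).trans ?_)
  refine (mul_le_of_le_one_right (norm_nonneg _) h').trans ((norm_mul_le _ _).trans ?_)
  exact mul_le_of_le_one_left (norm_nonneg _) h

theorem exists_norm_fockU_conj_apply_le {n : ℕ} (A : Op n) :
    ∃ C : ℝ, ∀ (u : ModeUnitary n) (x y : Occ n), ‖(fockU (u : Matrix (Fin n) (Fin n) ℂ) * A *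
      (fockU (u : Matrix (Fin n) (Fin n) ℂ)).conjTranspose) x y‖ ≤ C :=
  ⟨‖A‖, fun u x y => norm_fockU_conj_apply_le u.2 A x y⟩

theorem norm_fockU_conj_corr_apply_le {n k : ℕ} {u : Matrix (Fin n) (Fin n) ℂ}
    (hu : u ∈ Matrix.unitaryGroup (Fin n) ℂ) (i j : Fin k → Fin n) (x y : Occ n) :
    ‖(fockU u * corr i j * (fockU u).conjTranspose) x y‖ ≤ 1 :=
  (norm_fockU_conj_apply_le hu _ x y).trans (norm_corr_le i j)

end Norm

theorem norm_estimate_le {n k : ℕ} (ν : Measure (ModeUnitary n)) [IsProbabilityMeasure ν]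
    {O : Op n} (hO : O ∈ twoKPointSpace n k) (d : ModeUnitary n × Occ n) :
    ‖estimate ν O d‖ ≤ fBound k ν O := by
  rw [estimate, pinv_channel_eq_sum ν hO, Finset.mul_sum, Finset.sum_mul, Matrix.sum_apply]
  refine (norm_sum_le _ _).trans (Finset.sum_le_sum fun s _ => ?_)
  rw [mul_smul_comm, smul_mul_assoc, Matrix.smul_apply, smul_eq_mul, norm_mul]
  exact mul_le_of_le_one_right (norm_nonneg _)
    (norm_fockU_conj_corr_apply_le d.1.2 _ _ _ _)

/-! ### Inverting the channel, and unbiasedness of one round. -/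

theorem pinv_channel_eq_zero_of_fBound_eq_zero {n k : ℕ} (ν : Measure (ModeUnitary n))
    [IsProbabilityMeasure ν] {O : Op n} (hO : O ∈ twoKPointSpace n k) (h : fBound k ν O = 0) :
    pinv (channel ν) O = 0 := by
  rw [fBound, Finset.sum_eq_zero_iff_of_nonneg fun _ _ => norm_nonneg _] at h
  rw [pinv_channel_eq_sum ν hO]
  refine Finset.sum_eq_zero fun s hs => ?_
  rw [norm_eq_zero.mp (h s hs), zero_smul]

theorem channel_pinv_of_mem_range {n : ℕ} (ν : Measure (ModeUnitary n)) [IsProbabilityMeasure ν]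
    {O : Op n} (hO : O ∈ LinearMap.range (channel ν)) : channel ν (pinv (channel ν) O) = O := by
  obtain ⟨A, rfl⟩ := hO
  exact (isMoorePenrose_pinv _).map_inv_map A

theorem posSemidef_withAncilla {L : ℕ} (Lanc : ℕ) {ρ : Op L} (hρ : ρ.PosSemidef) :
    (withAncilla Lanc ρ).PosSemidef := by
  -- `V` is the embedding |z⟩ ↦ |z, 0⟩, and `withAncilla Lanc ρ` is VρV†.
  let V : Matrix (Occ (L + Lanc)) (Occ L) ℂ := Matrix.of fun x z =>
    if (∀ a : Fin Lanc, x (Fin.natAdd L a) = false) ∧ z = fun i => x (Fin.castAdd Lanc i)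
    then 1 else 0
  have h : withAncilla Lanc ρ = V * ρ * V.conjTranspose := by
    ext x y
    rw [Matrix.mul_apply, Finset.sum_eq_single fun i => y (Fin.castAdd Lanc i)]
    · rw [Matrix.mul_apply, Finset.sum_eq_single fun i => x (Fin.castAdd Lanc i)]
      · simp only [withAncilla, V, Matrix.conjTranspose_apply, Matrix.of_apply, and_true,
          forall_and]
        split_ifs <;> simp_all
      · intro z _ hz
        simp [V, hz]
      · simp
    · intro z _ hz
      simp [V, hz]
    · simp
  rw [h]
  exact hρ.mul_mul_conjTranspose_same V

theorem measurable_fockU_conj_apply {n : ℕ} (A : Op n) :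
    Measurable fun d : ModeUnitary n × Occ n =>
      (fockU (d.1 : Matrix (Fin n) (Fin n) ℂ) * A *
        (fockU (d.1 : Matrix (Fin n) (Fin n) ℂ)).conjTranspose) d.2 d.2 := by
  refine measurable_from_prod_countable_left fun x => Continuous.measurable ?_
  have hF := continuous_fockU n
  exact ((hF.matrix_mul continuous_const).matrix_mul hF.matrix_conjTranspose).matrix_elem x x

theorem measurable_estimate {n : ℕ} (ν : Measure (ModeUnitary n)) [IsProbabilityMeasure ν]
    (O : Op n) : Measurable (estimate ν O) :=
  measurable_fockU_conj_apply _

/-- The single-round estimate is unbiased. -/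
theorem integral_estimate {n : ℕ} (ν : Measure (ModeUnitary n)) [IsProbabilityMeasure ν]
    {σ : Op n} (hσ : σ.PosSemidef) {O : Op n} (hO : O ∈ LinearMap.range (channel ν)) :
    ∫ d, estimate ν O d ∂(roundLaw ν σ) = (σ * O).trace := by
  have hm : Measurable fun d : ModeUnitary n × Occ n =>
      ENNReal.ofReal ((fockU (d.1 : Matrix (Fin n) (Fin n) ℂ) * σ *
        (fockU (d.1 : Matrix (Fin n) (Fin n) ℂ)).conjTranspose) d.2 d.2).re :=
    ENNReal.measurable_ofReal.comp (Complex.measurable_re.comp (measurable_fockU_conj_apply σ))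
  -- Diagonal entries of a positive semidefinite matrix are real and nonnegative, so neither the
  -- real part nor `ENNReal.ofReal` changes the outcome probability.
  have hdens : ∀ d : ModeUnitary n × Occ n,
      (ENNReal.ofReal ((fockU (d.1 : Matrix (Fin n) (Fin n) ℂ) * σ *
        (fockU (d.1 : Matrix (Fin n) (Fin n) ℂ)).conjTranspose) d.2 d.2).re).toReal •
          estimate ν O d = estimate ν O d * (fockU (d.1 : Matrix (Fin n) (Fin n) ℂ) * σ *
        (fockU (d.1 : Matrix (Fin n) (Fin n) ℂ)).conjTranspose) d.2 d.2 := by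
    intro d
    have h0 := (hσ.mul_mul_conjTranspose_same
      (fockU (d.1 : Matrix (Fin n) (Fin n) ℂ))).diag_nonneg (i := d.2)
    rw [ENNReal.toReal_ofReal (Complex.nonneg_iff.mp h0).1, Complex.real_smul, mul_comm]
    congr 1
    exact (Complex.eq_re_of_ofReal_le h0).symm
  have hint : Integrable (fun d : ModeUnitary n × Occ n => estimate ν O d *
      (fockU (d.1 : Matrix (Fin n) (Fin n) ℂ) * σ *
        (fockU (d.1 : Matrix (Fin n) (Fin n) ℂ)).conjTranspose) d.2 d.2)
      (ν.prod Measure.count) := by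
    obtain ⟨C, hC⟩ := exists_norm_fockU_conj_apply_le (pinv (channel ν) O)
    obtain ⟨C', hC'⟩ := exists_norm_fockU_conj_apply_le σ
    refine Integrable.of_bound (C := C * C')
      ((measurable_estimate ν O).mul (measurable_fockU_conj_apply σ)).aestronglyMeasurable
      (Filter.Eventually.of_forall fun d => ?_)
    rw [norm_mul]
    exact mul_le_mul (hC d.1 d.2 d.2) (hC' d.1 d.2 d.2) (norm_nonneg _)
      ((norm_nonneg _).trans (hC d.1 d.2 d.2))
  -- The functional Tr(σ ·) applied to 𝓜(𝓜⁺(O)) = O turns Tr(σ O) into the average over u of the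
  -- estimate weighted by the outcome probabilities.
  have htr := map_channel ν (pinv (channel ν) O) (Matrix.traceLinearMap (Occ n) ℂ ℂ ∘ₗ
    LinearMap.mulLeft ℂ σ)
  simp only [LinearMap.comp_apply, LinearMap.mulLeft_apply, Matrix.traceLinearMap_apply,
    trace_mul_shot, channel_pinv_of_mem_range ν hO] at htr
  rw [roundLaw, integral_withDensity_eq_integral_toReal_smul hm
    (Filter.Eventually.of_forall fun _ => ENNReal.ofReal_lt_top)]
  simp only [hdens]
  rw [integral_prod _ hint, htr]
  congr 1
  funext u
  rw [integral_fintype (Integrable.of_finite)]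
  simp [estimate]

/-! ### Hoeffding bounds for real and complex means. -/

/-- Two-sided Hoeffding inequality for sums of independent variables with values in `[-c, c]`. -/
theorem measure_abs_sum_ge_le {Ω : Type*} [MeasurableSpace Ω] {μ : Measure Ω}
    [IsProbabilityMeasure μ] {N : ℕ} {X : Fin N → Ω → ℝ} (hX : ∀ m, AEMeasurable (X m) μ)
    (hind : iIndepFun X μ) {c a t : ℝ} (hc : ∀ m ω, |X m ω| ≤ c) (ha : ∀ m, ∫ ω, X m ω ∂μ = a)
    (ht : 0 ≤ t) :
    μ.real {ω | t ≤ |∑ m, (X m ω - a)|} ≤ 2 * Real.exp (-t ^ 2 / (2 * (N * c ^ 2))) := by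
  have hsub : ∀ m, HasSubgaussianMGF (fun ω => X m ω - a) ((‖c - -c‖₊ / 2) ^ 2) μ := by
    intro m
    rw [← ha m]
    exact hasSubgaussianMGF_of_mem_Icc (hX m)
      (Filter.Eventually.of_forall fun ω => abs_le.mp (hc m ω))
  have hsub' : ∀ m, HasSubgaussianMGF (fun ω => -(X m ω - a)) ((‖c - -c‖₊ / 2) ^ 2) μ :=
    fun m => (hsub m).neg
  have hind1 : iIndepFun (fun m ω => X m ω - a) μ :=
    hind.comp (fun _ x => x - a) fun _ => measurable_id.sub_const a
  have hind2 : iIndepFun (fun m ω => -(X m ω - a)) μ :=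
    hind.comp (fun _ x => -(x - a)) fun _ => (measurable_id.sub_const a).neg
  have hconst : ((∑ _m : Fin N, ((‖c - -c‖₊ / 2) ^ 2) : NNReal) : ℝ) = N * c ^ 2 := by
    have : c - -c = 2 * c := by ring
    rw [this]
    simp [sq_abs]
  have h1 := HasSubgaussianMGF.measure_sum_ge_le_of_iIndepFun hind1 (s := Finset.univ)
    (fun m _ => hsub m) ht
  have h2 := HasSubgaussianMGF.measure_sum_ge_le_of_iIndepFun hind2 (s := Finset.univ)
    (fun m _ => hsub' m) ht
  rw [hconst] at h1 h2
  have hle : {ω | t ≤ |∑ m, (X m ω - a)|} ⊆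
      {ω | t ≤ ∑ m, (X m ω - a)} ∪ {ω | t ≤ ∑ m, -(X m ω - a)} := by
    intro ω hω
    rcases le_abs.mp (show t ≤ |_| from hω) with h | h
    · exact Or.inl h
    · right
      rw [Set.mem_ofPred_eq, Finset.sum_neg_distrib]
      exact h
  calc _ ≤ _ := measureReal_mono hle
    _ ≤ _ := measureReal_union_le _ _
    _ ≤ _ := add_le_add h1 h2
    _ = _ := by ring

/-- Hoeffding's inequality for means of bounded independent complex random variables. -/
theorem measure_norm_mean_sub_ge_le {Ω : Type*} [MeasurableSpace Ω] {μ : Measure Ω}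
    [IsProbabilityMeasure μ] {N : ℕ} (hN : 0 < N) {X : Fin N → Ω → ℂ}
    (hX : ∀ m, AEMeasurable (X m) μ) (hind : iIndepFun X μ) {c ε : ℝ} {a : ℂ}
    (hc : ∀ m ω, ‖X m ω‖ ≤ c) (ha : ∀ m, ∫ ω, X m ω ∂μ = a) (hε : 0 ≤ ε) :
    μ.real {ω | ε ≤ ‖(1 / (N : ℂ)) * ∑ m, X m ω - a‖} ≤
      4 * Real.exp (-(N * ε ^ 2 / (4 * c ^ 2))) := by
  have hN' : (0 : ℝ) < N := Nat.cast_pos.mpr hN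
  have hint : ∀ m, Integrable (X m) μ := fun m =>
    Integrable.of_bound (hX m).aestronglyMeasurable c (Filter.Eventually.of_forall (hc m))
  -- A complex number of modulus at least Nε has real or imaginary part of modulus at least Nε/√2.
  -- This threshold turns Hoeffding's exponent t²/(2Nc²) into Nε²/(4c²), and two parts with two
  -- tails each give the prefactor 4.
  have hre := measure_abs_sum_ge_le (μ := μ) (X := fun m ω => (X m ω).re) (c := c) (a := a.re)
    (t := N * ε / √2) (fun m => Complex.measurable_re.comp_aemeasurable (hX m))
    (hind.comp (fun _ => Complex.re) fun _ => Complex.measurable_re)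
    (fun m ω => (Complex.abs_re_le_norm _).trans (hc m ω))
    (fun m => by rw [← ha m]; exact integral_re (hint m)) (by positivity)
  have him := measure_abs_sum_ge_le (μ := μ) (X := fun m ω => (X m ω).im) (c := c) (a := a.im)
    (t := N * ε / √2) (fun m => Complex.measurable_im.comp_aemeasurable (hX m))
    (hind.comp (fun _ => Complex.im) fun _ => Complex.measurable_im)
    (fun m ω => (Complex.abs_im_le_norm _).trans (hc m ω))
    (fun m => by rw [← ha m]; exact integral_im (hint m)) (by positivity)
  have hexp : -(N * ε / √2) ^ 2 / (2 * (N * c ^ 2)) = -(N * ε ^ 2 / (4 * c ^ 2)) := by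
    rw [div_pow, Real.sq_sqrt (by norm_num)]
    rcases eq_or_ne c 0 with rfl | h
    · simp
    · field_simp
      norm_num
  rw [hexp] at hre him
  have hle : {ω | ε ≤ ‖(1 / (N : ℂ)) * ∑ m, X m ω - a‖} ⊆
      {ω | N * ε / √2 ≤ |∑ m, ((X m ω).re - a.re)|} ∪
        {ω | N * ε / √2 ≤ |∑ m, ((X m ω).im - a.im)|} := by
    intro ω hω
    have hω : ε ≤ ‖(1 / (N : ℂ)) * ∑ m, X m ω - a‖ := hω
    set z : ℂ := ∑ m, (X m ω - a) with hz
    have hzre : ∑ m, ((X m ω).re - a.re) = z.re := by simp [hz]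
    have hzim : ∑ m, ((X m ω).im - a.im) = z.im := by simp [hz]
    have hmean : (1 / (N : ℂ)) * ∑ m, X m ω - a = (1 / (N : ℂ)) * z := by
      have : (N : ℂ) ≠ 0 := Nat.cast_ne_zero.mpr hN.ne'
      rw [hz, Finset.sum_sub_distrib]
      simp only [Finset.sum_const, Finset.card_univ, Fintype.card_fin, nsmul_eq_mul]
      field_simp
    rw [hmean, norm_mul, norm_div, norm_one, Complex.norm_natCast, one_div_mul_eq_div,
      le_div_iff₀ hN'] at hω
    by_contra hcon
    rw [Set.mem_union, not_or, Set.mem_ofPred_eq, Set.mem_ofPred_eq, hzre, hzim, not_le,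
      not_le] at hcon
    have h2 : (N * ε / √2) ^ 2 = (ε * N) ^ 2 / 2 := by
      rw [div_pow, Real.sq_sqrt (by norm_num), mul_comm]
    have h3 := pow_lt_pow_left₀ hcon.1 (abs_nonneg _) two_ne_zero
    have h4 := pow_lt_pow_left₀ hcon.2 (abs_nonneg _) two_ne_zero
    have h5 := pow_le_pow_left₀ (by positivity) hω 2
    rw [sq_abs, h2] at h3 h4
    rw [Complex.sq_norm, Complex.normSq_apply] at h5
    linarith
  calc _ ≤ _ := measureReal_mono hle
    _ ≤ _ := measureReal_union_le _ _
    _ ≤ _ := add_le_add hre him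
    _ = _ := by ring

end FermionShadows

/-! ### The sample-complexity bound. -/

open FermionShadows in
theorem mainTheorem9 {L Lanc k N : ℕ}
    (ν : Measure (FermionShadows.ModeUnitary (L + Lanc))) [IsProbabilityMeasure ν]
    (ρ : FermionShadows.Op L) (hρ : FermionShadows.IsDensity ρ)
    (S : Finset ((Fin k → Fin L) × (Fin k → Fin L))) (hS : S.Nonempty)
    (O : (Fin k → Fin L) × (Fin k → Fin L) → FermionShadows.Op (L + Lanc))
    (hO_mem : ∀ p ∈ S, O p ∈ FermionShadows.twoKPointSpace (L + Lanc) k)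
    (hO_range : ∀ p ∈ S, O p ∈ LinearMap.range (FermionShadows.channel ν))
    (hO_trace : ∀ p ∈ S, (FermionShadows.withAncilla Lanc ρ * O p).trace =
      (ρ * FermionShadows.corr p.1 p.2).trace)
    (ε δ : ℝ) (hε : 0 < ε) (hδ : 0 < δ)
    (hN : 4 / ε ^ 2 * Real.log (4 * (S.card : ℝ) / δ) *
      S.sup' hS (fun p => FermionShadows.fBound k ν (O p) ^ 2) ≤ (N : ℝ))
    {Ω : Type*} [MeasurableSpace Ω] (μ : Measure Ω) [IsProbabilityMeasure μ]
    (D : Fin N → Ω → FermionShadows.ModeUnitary (L + Lanc) × FermionShadows.Occ (L + Lanc))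
    (hD_law : ∀ m, HasLaw (D m)
      (FermionShadows.roundLaw ν (FermionShadows.withAncilla Lanc ρ)) μ)
    (hD_indep : iIndepFun D μ) :
    1 - δ ≤ μ.real {ω | ∀ p ∈ S,
      ‖(1 / (N : ℂ)) * ∑ m, FermionShadows.estimate ν (O p) (D m ω) -
        (ρ * FermionShadows.corr p.1 p.2).trace‖ < ε} := by
  -- For δ ≥ 1 the claim is trivial; for δ < 1 the logarithm is positive, as the bound on `N`
  -- requires.
  rcases le_or_gt 1 δ with hδ1 | hδ1
  · exact (sub_nonpos.mpr hδ1).trans measureReal_nonneg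
  have hcard : (1 : ℝ) ≤ S.card := by exact_mod_cast hS.card_pos
  have hlog : 0 < Real.log (4 * (S.card : ℝ) / δ) :=
    Real.log_pos (by rw [lt_div_iff₀ hδ]; linarith)
  let bad : (Fin k → Fin L) × (Fin k → Fin L) → Set Ω := fun p =>
    {ω | ε ≤ ‖(1 / (N : ℂ)) * ∑ m, estimate ν (O p) (D m ω) - (ρ * corr p.1 p.2).trace‖}
  have hbad : ∀ p ∈ S, μ.real (bad p) ≤ δ / S.card := by
    intro p hp
    have hf0 : 0 ≤ fBound k ν (O p) := Finset.sum_nonneg fun _ _ => norm_nonneg _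
    -- If f(O) = 0 the hypothesis on `N` may allow `N = 0`, but then 𝓜⁺(O) = 0 and O = 𝓜(𝓜⁺(O)) = 0,
    -- so estimate and target both vanish. If f(O) > 0 the hypothesis forces `N > 0`.
    rcases hf0.eq_or_lt with hf | hf
    · have h0 := pinv_channel_eq_zero_of_fBound_eq_zero ν (hO_mem p hp) hf.symm
      have hO : O p = 0 := by
        rw [← channel_pinv_of_mem_range ν (hO_range p hp), h0, map_zero]
      have hempty : bad p = ∅ := by
        refine Set.eq_empty_of_forall_notMem fun ω hω => ?_
        have hω : ε ≤ ‖_‖ := hω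
        rw [← hO_trace p hp] at hω
        simp only [estimate, hO] at hω
        simp at hω
        exact hω.not_gt hε
      rw [hempty, measureReal_empty]
      positivity
    · have hsup := Finset.le_sup' (fun p => fBound k ν (O p) ^ 2) hp
      have hN1 : 4 / ε ^ 2 * Real.log (4 * (S.card : ℝ) / δ) * fBound k ν (O p) ^ 2 ≤ N :=
        (mul_le_mul_of_nonneg_left hsup (by positivity)).trans hN
      have hNpos : 0 < N := by
        have : (0 : ℝ) < N := lt_of_lt_of_le (by positivity) hN1
        exact_mod_cast this
      have hmean : ∀ m, ∫ ω, estimate ν (O p) (D m ω) ∂μ = (ρ * corr p.1 p.2).trace := by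
        intro m
        have := (hD_law m).integral_comp (measurable_estimate ν (O p)).aestronglyMeasurable
        rw [integral_estimate ν (posSemidef_withAncilla Lanc hρ.1) (hO_range p hp),
          hO_trace p hp] at this
        exact this
      have h := measure_norm_mean_sub_ge_le (μ := μ) hNpos
        (X := fun m ω => estimate ν (O p) (D m ω))
        (fun m => (measurable_estimate ν (O p)).comp_aemeasurable (hD_law m).aemeasurable)
        (hD_indep.comp (fun _ => estimate ν (O p)) fun _ => measurable_estimate ν (O p))
        (fun m ω => norm_estimate_le ν (hO_mem p hp) _) hmean hε.le
      refine h.trans ?_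
      have hexp : Real.log (4 * (S.card : ℝ) / δ) ≤ N * ε ^ 2 / (4 * fBound k ν (O p) ^ 2) := by
        rw [le_div_iff₀ (by positivity)]
        calc _ = 4 / ε ^ 2 * Real.log (4 * (S.card : ℝ) / δ) * fBound k ν (O p) ^ 2 * ε ^ 2 := by
              field_simp
          _ ≤ _ := mul_le_mul_of_nonneg_right hN1 (by positivity)
      calc _ ≤ 4 * Real.exp (-Real.log (4 * (S.card : ℝ) / δ)) := by gcongr
        _ = δ / S.card := by
          rw [Real.exp_neg, Real.exp_log (by positivity)]
          field_simp
  have hunion : μ.real (⋃ p ∈ S, bad p) ≤ δ :=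
    calc _ ≤ ∑ p ∈ S, μ.real (bad p) := measureReal_biUnion_finset_le _ _
      _ ≤ ∑ p ∈ S, δ / S.card := Finset.sum_le_sum hbad
      _ = δ := by
        rw [Finset.sum_const, nsmul_eq_mul]
        field_simp
  -- Covering the whole space and using subadditivity avoids any measurability claim about the good
  -- event.
  have hcover : (Set.univ : Set Ω) ⊆ {ω | ∀ p ∈ S,
      ‖(1 / (N : ℂ)) * ∑ m, estimate ν (O p) (D m ω) - (ρ * corr p.1 p.2).trace‖ < ε} ∪
        ⋃ p ∈ S, bad p := by
    intro ω _
    by_contra hω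
    rw [Set.mem_union, not_or] at hω
    refine hω.1 fun p hp => ?_
    by_contra hp'
    exact hω.2 (Set.mem_biUnion hp (not_lt.mp hp'))
  have htot := (measureReal_mono hcover (μ := μ)).trans (measureReal_union_le _ _)
  rw [probReal_univ] at htot
  linarith
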